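/- **Theorem.** Let $\alpha=2^{1/3}$. For a graph $G$ let $\operatorname{perm}(G)$ be its number of perfect matchings (for a balanced bipartite graph this is the permanent of the bi-adjacency matrix). A bipartite graph is *balanced* if its two parts have the same size, and $C_4$-free if it contains no cycle of length $4$. Let $J$ be the graph with $8$ vertices and $9$ edges obtained from a $6$-cycle by joining two antipodal vertices by a further path of length $3$ (through two new vertices). (a) Let $G$ be a $C_4$-free balanced bipartite graph with $2n$ vertices and $n+k$ edges, where $n\ge 0$ and $k$ are integers. Then $\operatorname{perm}(G)\le \alpha^{k}$. (b) Let $H$ be a connected $C_4$-free balanced bipartite graph with $2n$ vertices, $n+k$ edges, minimum degree $\delta(H)\le 2$ and maximum degree $\Delta(H)\le 3$, and assume that $H$ is not isomorphic to $K_2$, $C_6$ or $J$. Then $\operatorname{perm}(H)\le c_1\,\alpha^{k}$, where $c_1=\alpha^{-2}+\alpha^{-7}\le (3\alpha^{-4})^{-1}$. (c) Let $H$ be a connected $C_4$-free balanced bipartite graph with $2n$ vertices, $n+k$ edges and minimum degree $\delta(H)\le 2$, and assume that $H$ is not isomorphic to $K_2$, $C_6$ or $J$. Then $\operatorname{perm}(H)\le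 c_2\,\alpha^{k}$, where $c_2=\alpha^{-3}+\alpha^{-4}\le (\alpha^{-1}+\alpha^{-5})^{-1}$. -/

import Mathlib

/-- `G` is a balanced bipartite graph with parts of size `n` (so `2 * n` vertices in total):
the vertex set is the disjoint union of two sets of size `n`, and every edge joins the two. -/
def IsBalancedBipartite {V : Type*} (G : SimpleGraph V) (n : ℕ) : Prop :=
  ∃ s t : Set V, G.IsBipartiteWith s t ∧ s ∪ t = Set.univ ∧ s.encard = n ∧ t.encard = n

/-- `perm G`: the number of perfect matchings of `G`. For a balanced bipartite graph this is the
permanent of the bi-adjacency matrix, see `permanent_biadjacency`. -/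
noncomputable def perm {V : Type*} (G : SimpleGraph V) : ℕ :=
  {M : G.Subgraph | M.IsPerfectMatching}.ncard

/-- The graph `J` on 8 vertices: a hexagon `0, 1, 2, 3, 4, 5` whose antipodal vertices `0` and `3`
are joined by a further path `0, 6, 7, 3` of length 3. -/
def graphJ : SimpleGraph (Fin 8) :=
  SimpleGraph.fromEdgeSet
    {s(0, 1), s(1, 2), s(2, 3), s(3, 4), s(4, 5), s(5, 0), s(0, 6), s(6, 7), s(7, 3)}

/-- `α = 2 ^ (1 / 3)`. -/
noncomputable def alpha : ℝ := (2 : ℝ) ^ ((1 : ℝ) / 3)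

/-- `c₁ = α⁻² + α⁻⁷`. -/
noncomputable def cOne : ℝ := alpha ^ (-2 : ℤ) + alpha ^ (-7 : ℤ)

/-- `c₂ = α⁻³ + α⁻⁴`. -/
noncomputable def cTwo : ℝ := alpha ^ (-3 : ℤ) + alpha ^ (-4 : ℤ)

/-- The subgraph consisting of the edges `x i` -- `y (σ i)`. -/
def matchingOf {V ι : Type*} (G : SimpleGraph V) (x y : ι → V) (σ : Equiv.Perm ι)
    (h : ∀ i, G.Adj (x i) (y (σ i))) : G.Subgraph where
  verts := Set.univ
  Adj u v := ∃ i, (u = x i ∧ v = y (σ i)) ∨ (v = x i ∧ u = y (σ i))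
  adj_sub := by
    rintro u v ⟨i, ⟨rfl, rfl⟩ | ⟨rfl, rfl⟩⟩
    exacts [h i, (h i).symm]
  edge_vert _ := Set.mem_univ _
  symm := ⟨fun u v ⟨i, h⟩ => ⟨i, h.symm⟩⟩

open Classical in
/-- If the two parts of a bipartite graph are enumerated by `x` and `y`, then `perm G` is the
permanent of the bi-adjacency matrix `(1 if x i is adjacent to y j, else 0)`. -/
theorem permanent_biadjacency {V ι : Type*} [Fintype ι] (G : SimpleGraph V)
    (x y : ι → V) (hx : Function.Injective x) (hy : Function.Injective y)
    (hG : G.IsBipartiteWith (Set.range x) (Set.range y))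
    (hcov : Set.range x ∪ Set.range y = Set.univ) :
    perm G = (Matrix.of fun i j => if G.Adj (x i) (y j) then (1 : ℕ) else 0).permanent := by
  have hdis : ∀ i j, x i ≠ y j := fun i j h =>
    Set.disjoint_left.1 hG.disjoint ⟨i, rfl⟩ ⟨j, h.symm⟩
  rw [← Matrix.permanent_transpose]
  unfold Matrix.permanent perm
  simp only [Matrix.transpose_apply, Matrix.of_apply, Finset.prod_ite_zero, Finset.prod_const_one,
    Finset.mem_univ, true_imp_iff, Finset.sum_boole, Nat.cast_id]
  rw [← Set.ncard_coe_finset]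
  symm
  refine Set.ncard_congr
    (fun σ hσ => matchingOf G x y σ (by simpa using hσ)) ?_ ?_ ?_
  · intro σ hσ
    refine ⟨?_, fun v => Set.mem_univ v⟩
    intro v _
    rcases (hcov ▸ Set.mem_univ v : v ∈ Set.range x ∪ Set.range y) with ⟨i, rfl⟩ | ⟨j, rfl⟩
    · refine ⟨y (σ i), ⟨i, Or.inl ⟨rfl, rfl⟩⟩, ?_⟩
      rintro w ⟨k, ⟨h1, h2⟩ | ⟨-, h2⟩⟩
      · rw [h2, hx h1]
      · exact absurd h2 (hdis _ _)
    · refine ⟨x (σ.symm j), ⟨σ.symm j, Or.inr ⟨rfl, by simp⟩⟩, ?_⟩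
      rintro w ⟨k, ⟨h1, -⟩ | ⟨h1, h2⟩⟩
      · exact absurd h1.symm (hdis _ _)
      · rw [h1, hy h2]; simp
  · intro σ τ hσ hτ h
    ext i
    have h1 : (matchingOf G x y σ (by simpa using hσ)).Adj (x i) (y (σ i)) :=
      ⟨i, Or.inl ⟨rfl, rfl⟩⟩
    have h2 : (matchingOf G x y τ (by simpa using hτ)).Adj (x i) (y (σ i)) := by
      rw [← h]; exact h1
    obtain ⟨k, ⟨h3, h4⟩ | ⟨h3, -⟩⟩ := h2
    · rw [← hx h3] at h4; exact hy h4
    · exact absurd h3.symm (hdis _ _)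
  · intro M hM
    have hM' := SimpleGraph.Subgraph.isPerfectMatching_iff.1 hM
    have key : ∀ i, ∃ j, M.Adj (x i) (y j) := by
      intro i
      obtain ⟨w, hw, -⟩ := hM' (x i)
      rcases hG.mem_of_adj (M.adj_sub hw) with ⟨-, j, rfl⟩ | ⟨⟨j, hj⟩, -⟩
      · exact ⟨j, hw⟩
      · exact absurd hj.symm (hdis _ _)
    choose f hf using key
    have hinj : Function.Injective f := by
      intro i k hik
      exact hx ((hM' (y (f i))).unique (hf i).symm (by rw [hik]; exact (hf k).symm))
    let σ : Equiv.Perm ι := Equiv.ofBijective f (Finite.injective_iff_bijective.1 hinj)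
    have hσ : ∀ i, M.Adj (x i) (y (σ i)) := hf
    refine ⟨σ, by simpa using fun i => M.adj_sub (hσ i), ?_⟩
    ext u v
    · exact ⟨fun _ => hM.2 u, fun _ => Set.mem_univ u⟩
    · constructor
      · rintro ⟨i, ⟨rfl, rfl⟩ | ⟨rfl, rfl⟩⟩
        exacts [hσ i, (hσ i).symm]
      · intro huv
        rcases hG.mem_of_adj (M.adj_sub huv) with ⟨⟨i, rfl⟩, -⟩ | ⟨-, ⟨i, rfl⟩⟩
        · exact ⟨i, Or.inl ⟨rfl, (hM' _).unique huv (hσ i)⟩⟩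
        · exact ⟨i, Or.inr ⟨rfl, (hM' _).unique huv.symm (hσ i)⟩⟩

/-! Expand the number of perfect matchings over smaller graphs and follow `k`. Deleting an edge
lowers `k` by 1. Deleting both ends of an edge `uv` lowers it by `d(u) + d(v) - 2`. Induction then
bounds the count by a sum of negative powers of `α` times `α ^ k`, and the task is to keep that sum
below the required constant. Intermediate vertex sets may be odd, so `weight` has a real exponent.

For minimum degree `d ≥ 4`, part (a) is the plain expansion: `d * α ^ (-(2d - 2)) ≤ 1`, with
equality at `d = 4`. With cubic vertices it fails, since `3 * α⁻⁴ > 1`. But removing an edge at a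
cubic vertex, or its two ends, creates vertices of degree 2, and the better constants for graphs
with such vertices close the gap: `3 * c₁ * α⁻⁴ ≤ 1` and `c₂ * (α⁻¹ + α⁻⁵) ≤ 1`. So (a), (b) and (c)
are proved together by induction on vertices and edges (`holds`).

For (b) and (c), expand along a chain of consecutive vertices of degree 2 (`two_chain`,
`three_chain`, `four_chain`) or at a single such vertex. Most cases give at most `α⁻¹`, `c₁` or `c₂`
directly. When the chain has one or two vertices and its outer neighbours are cubic, this is too
weak; induction is then applied to a component of the remainder that again has a vertex of degree 2.

That component may be `K₂`, `C₆` or `J`. In these graphs two vertices of the same colour always have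
a common neighbour, so by `C₄`-freeness an outside vertex sends at most one edge into them
(`Exc.eq_of_adj`). Either the graph then has a cut edge, where parity gains a factor `α⁻¹`
(`bridge`), or it is small enough to be identified or counted directly (`two_parts_bound`,
`two_chain_three`). -/

namespace C4Free

open scoped Classical

/-! ### Perfect matchings and excess of induced subgraphs -/

section

variable {V : Type*}

/-- The neighbours of `v` inside the vertex set `S`. -/
noncomputable def nb (G : SimpleGraph V) (S : Finset V) (v : V) : Finset V := S.filter (G.Adj v)

/-- Twice the number of edges minus the number of vertices of the graph induced on `S`. -/
noncomputable def excess (G : SimpleGraph V) (S : Finset V) : ℤ :=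
  ∑ v ∈ S, (((nb G S v).card : ℤ) - 1)

/-- Perfect matchings of the graph induced on `S`, encoded as involutions of `V` fixing exactly
the vertices outside `S`. -/
def IsPM (G : SimpleGraph V) (S : Finset V) (f : V → V) : Prop :=
  (∀ v ∈ S, G.Adj v (f v)) ∧ (∀ v ∉ S, f v = v) ∧ ∀ v, f (f v) = v

/-- The number of perfect matchings of the graph induced on `S`. -/
noncomputable def numPM (G : SimpleGraph V) (S : Finset V) : ℕ := {f | IsPM G S f}.ncard

theorem mem_nb {G : SimpleGraph V} {S : Finset V} {v w : V} :
    w ∈ nb G S v ↔ w ∈ S ∧ G.Adj v w := by simp [nb]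

theorem nb_erase (G : SimpleGraph V) (S : Finset V) (x v : V) :
    nb G (S.erase x) v = (nb G S v).erase x := by
  ext w; simp only [mem_nb, Finset.mem_erase]; tauto

theorem excess_erase (G : SimpleGraph V) {S : Finset V} {v : V} (hv : v ∈ S) :
    excess G (S.erase v) = excess G S - (2 * ((nb G S v).card : ℤ) - 1) := by
  have h1 : ∀ u ∈ S.erase v, (((nb G (S.erase v) u).card : ℤ) - 1)
      = (((nb G S u).card : ℤ) - 1) - if G.Adj v u then 1 else 0 := by
    intro u hu
    rw [nb_erase]
    split_ifs with h
    · have : v ∈ nb G S u := mem_nb.2 ⟨hv, h.symm⟩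
      have := Finset.card_erase_add_one this
      omega
    · have : v ∉ nb G S u := fun h' => h (mem_nb.1 h').2.symm
      rw [Finset.erase_eq_of_notMem this]; ring
  have h2 : (∑ u ∈ S.erase v, if G.Adj v u then (1 : ℤ) else 0) = (nb G S v).card := by
    rw [Finset.sum_boole]
    congr 2
    ext w
    simp only [mem_nb, Finset.mem_filter, Finset.mem_erase]
    constructor
    · tauto
    · rintro ⟨h, h'⟩; exact ⟨⟨h'.ne', h⟩, h'⟩
  unfold excess
  rw [Finset.sum_congr rfl h1, Finset.sum_sub_distrib, h2, ← Finset.add_sum_erase S _ hv]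
  ring

theorem nb_congr {G H : SimpleGraph V} {S : Finset V}
    (h : ∀ u ∈ S, ∀ v ∈ S, G.Adj u v ↔ H.Adj u v) {v : V} (hv : v ∈ S) : nb G S v = nb H S v := by
  ext w; simp only [mem_nb]
  exact and_congr_right fun hw => h v hv w hw

theorem excess_congr {G H : SimpleGraph V} {S : Finset V}
    (h : ∀ u ∈ S, ∀ v ∈ S, G.Adj u v ↔ H.Adj u v) : excess G S = excess H S :=
  Finset.sum_congr rfl fun v hv => by rw [nb_congr h hv]

theorem IsPM.mem {G : SimpleGraph V} {S : Finset V} {f : V → V} (hf : IsPM G S f) {v : V}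
    (hv : v ∈ S) : f v ∈ S := by
  by_contra h
  have h1 := hf.2.1 _ h
  rw [hf.2.2] at h1
  exact (hf.1 v hv).ne h1

theorem numPM_congr {G H : SimpleGraph V} {S : Finset V}
    (h : ∀ u ∈ S, ∀ v ∈ S, G.Adj u v ↔ H.Adj u v) : numPM G S = numPM H S := by
  unfold numPM
  congr 1
  ext f
  simp only [Set.mem_ofPred_eq]
  constructor
  · intro hf; exact ⟨fun v hv => (h v hv _ (hf.mem hv)).1 (hf.1 v hv), hf.2⟩
  · intro hf; exact ⟨fun v hv => (h v hv _ (hf.mem hv)).2 (hf.1 v hv), hf.2⟩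

theorem numPM_empty (G : SimpleGraph V) : numPM G ∅ = 1 := by
  unfold numPM
  rw [Set.ncard_eq_one]
  refine ⟨id, ?_⟩
  ext f
  simp only [Set.mem_ofPred_eq, Set.mem_singleton_iff]
  constructor
  · intro h; funext v; exact h.2.1 v (by simp)
  · rintro rfl; exact ⟨by simp, by simp, by simp⟩

theorem numPM_fiber (G : SimpleGraph V) {S : Finset V} {v w : V} (hv : v ∈ S)
    (hw : w ∈ nb G S v) :
    {f | IsPM G S f ∧ f v = w}.ncard = numPM G ((S.erase v).erase w) := by
  obtain ⟨hwS, hvw⟩ := mem_nb.1 hw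
  have hne := hvw.ne
  unfold numPM
  refine Set.ncard_congr (fun f _ => Function.update (Function.update f v v) w w) ?_ ?_ ?_
  · rintro f ⟨hf, hfv⟩
    have hfw : f w = v := by rw [← hfv, hf.2.2]
    have hfu : ∀ u, u ≠ v → u ≠ w → f u ≠ v ∧ f u ≠ w := by
      intro u h1 h2
      refine ⟨fun h => h2 ?_, fun h => h1 ?_⟩
      · rw [← hf.2.2 u, h, hfv]
      · rw [← hf.2.2 u, h, hfw]
    refine ⟨?_, ?_, ?_⟩
    · intro u hu
      simp only [Finset.mem_erase] at hu
      rw [Function.update_of_ne hu.1, Function.update_of_ne hu.2.1]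
      exact hf.1 u hu.2.2
    · intro u hu
      by_cases h1 : u = w
      · subst h1; simp
      by_cases h2 : u = v
      · subst h2; rw [Function.update_of_ne h1]; simp
      rw [Function.update_of_ne h1, Function.update_of_ne h2]
      exact hf.2.1 u fun h => hu (by simp [h1, h2, h])
    · intro u
      by_cases h1 : u = w
      · subst h1; simp
      by_cases h2 : u = v
      · subst h2; simp [Function.update_of_ne h1]
      simp only [Function.update_of_ne h1, Function.update_of_ne h2]
      rw [Function.update_of_ne (hfu u h2 h1).2, Function.update_of_ne (hfu u h2 h1).1]
      exact hf.2.2 u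
  · rintro f g ⟨hf, hfv⟩ ⟨hg, hgv⟩ h
    have hfw : f w = v := by rw [← hfv, hf.2.2]
    have hgw : g w = v := by rw [← hgv, hg.2.2]
    funext u
    by_cases h1 : u = w
    · rw [h1, hfw, hgw]
    by_cases h2 : u = v
    · rw [h2, hfv, hgv]
    have := congrFun h u
    simpa only [Function.update_of_ne h1, Function.update_of_ne h2] using this
  · intro g hg
    have hgv : g v = v := hg.2.1 v (by simp)
    have hgw : g w = w := hg.2.1 w (by simp)
    have hgu : ∀ u, u ≠ v → u ≠ w → g u ≠ v ∧ g u ≠ w := by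
      intro u h1 h2
      refine ⟨fun h => h1 ?_, fun h => h2 ?_⟩
      · rw [← hg.2.2 u, h, hgv]
      · rw [← hg.2.2 u, h, hgw]
    refine ⟨Function.update (Function.update g v w) w v, ⟨⟨?_, ?_, ?_⟩, ?_⟩, ?_⟩
    · intro u hu
      by_cases h1 : u = w
      · subst h1; simpa using hvw.symm
      by_cases h2 : u = v
      · subst h2; simpa [Function.update_of_ne h1] using hvw
      rw [Function.update_of_ne h1, Function.update_of_ne h2]
      exact hg.1 u (by simp [h1, h2, hu])
    · intro u hu
      have h1 : u ≠ w := fun h => hu (h ▸ hwS)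
      have h2 : u ≠ v := fun h => hu (h ▸ hv)
      rw [Function.update_of_ne h1, Function.update_of_ne h2]
      exact hg.2.1 u (by simp [hu])
    · intro u
      by_cases h1 : u = w
      · subst h1; simp [Function.update_of_ne hne]
      by_cases h2 : u = v
      · subst h2; simp [Function.update_of_ne h1]
      simp only [Function.update_of_ne h1, Function.update_of_ne h2]
      rw [Function.update_of_ne (hgu u h2 h1).2, Function.update_of_ne (hgu u h2 h1).1]
      exact hg.2.2 u
    · rw [Function.update_of_ne hne]; simp
    · funext u
      by_cases h1 : u = w
      · subst h1; simp [hgw]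
      by_cases h2 : u = v
      · subst h2; simp [Function.update_of_ne h1, hgv]
      simp only [Function.update_of_ne h1, Function.update_of_ne h2]

/-- Expansion of the number of perfect matchings along a vertex. -/
theorem numPM_expand [Finite V] (G : SimpleGraph V) {S : Finset V} {v : V} (hv : v ∈ S) :
    numPM G S = ∑ w ∈ nb G S v, numPM G ((S.erase v).erase w) := by
  have := Fintype.ofFinite V
  have h1 : numPM G S = (Finset.univ.filter (IsPM G S)).card := by
    unfold numPM; rw [← Set.ncard_coe_finset]; simp
  rw [h1, Finset.card_eq_sum_card_fiberwise (f := fun f => f v) (t := nb G S v)]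
  · refine Finset.sum_congr rfl fun w hw => ?_
    rw [← numPM_fiber G hv hw, ← Set.ncard_coe_finset]
    congr 1; ext f; simp
  · intro f hf
    have hf : IsPM G S f := by simpa using hf
    exact mem_nb.2 ⟨hf.mem hv, hf.1 v hv⟩

theorem numPM_eq_zero [Finite V] {G : SimpleGraph V} {S : Finset V} {v : V} (hv : v ∈ S)
    (h : nb G S v = ∅) : numPM G S = 0 := by rw [numPM_expand G hv, h]; simp

theorem numPM_leaf [Finite V] {G : SimpleGraph V} {S : Finset V} {v u : V} (hv : v ∈ S)
    (h : nb G S v = {u}) : numPM G S = numPM G ((S.erase v).erase u) := by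
  rw [numPM_expand G hv, h]; simp

theorem numPM_pair [Finite V] {G : SimpleGraph V} {S : Finset V} {v u w : V} (hv : v ∈ S)
    (h : nb G S v = {u, w}) (huw : u ≠ w) :
    numPM G S = numPM G ((S.erase v).erase u) + numPM G ((S.erase v).erase w) := by
  rw [numPM_expand G hv, h, Finset.sum_pair huw]

theorem even_card_of_numPM_ne_zero [Finite V] (G : SimpleGraph V) (S : Finset V) (h : numPM G S ≠ 0) :
    Even S.card := by
  induction hn : S.card using Nat.strong_induction_on generalizing S with
  | _ n ih =>
    rcases S.eq_empty_or_nonempty with rfl | ⟨v, hv⟩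
    · simp at hn; simp [← hn]
    · rw [numPM_expand G hv] at h
      obtain ⟨w, hw, hne⟩ := Finset.exists_ne_zero_of_sum_ne_zero h
      obtain ⟨hwS, hvw⟩ := mem_nb.1 hw
      have h1 := Finset.card_erase_add_one hv
      have h2 := Finset.card_erase_add_one (Finset.mem_erase.2 ⟨hvw.ne', hwS⟩)
      have := ih _ (by omega) _ hne rfl
      rw [← hn, ← h1, ← h2]
      exact this.add (by decide : Even 2)

end

/-! ### Connected components -/

section

variable {V : Type*}

/-- `A` is a union of connected components of the graph induced on `S`. -/
def IsClosedIn (G : SimpleGraph V) (S A : Finset V) : Prop :=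
  A ⊆ S ∧ ∀ a ∈ A, ∀ b ∈ S, G.Adj a b → b ∈ A

/-- The graph induced on `S` is connected. -/
def Conn (G : SimpleGraph V) (S : Finset V) : Prop :=
  S.Nonempty ∧ ∀ A, IsClosedIn G S A → A.Nonempty → A = S

theorem IsClosedIn.compl {G : SimpleGraph V} {S A : Finset V} (h : IsClosedIn G S A) :
    IsClosedIn G S (S \ A) := by
  refine ⟨Finset.sdiff_subset, fun a ha b hb hab => ?_⟩
  simp only [Finset.mem_sdiff] at ha ⊢
  exact ⟨hb, fun hbA => ha.2 (h.2 b hbA a ha.1 hab.symm)⟩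

theorem IsClosedIn.nb_eq {G : SimpleGraph V} {S A : Finset V} (h : IsClosedIn G S A) {a : V}
    (ha : a ∈ A) : nb G A a = nb G S a := by
  ext w; simp only [mem_nb]
  exact ⟨fun hw => ⟨h.1 hw.1, hw.2⟩, fun hw => ⟨h.2 a ha w hw.1 hw.2, hw.2⟩⟩

theorem IsClosedIn.excess_add {G : SimpleGraph V} {S A : Finset V} (h : IsClosedIn G S A) :
    excess G S = excess G A + excess G (S \ A) := by
  have h1 : excess G A = ∑ v ∈ A, (((nb G S v).card : ℤ) - 1) :=
    Finset.sum_congr rfl fun a ha => by rw [h.nb_eq ha]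
  have h2 : excess G (S \ A) = ∑ v ∈ S \ A, (((nb G S v).card : ℤ) - 1) :=
    Finset.sum_congr rfl fun a ha => by rw [h.compl.nb_eq ha]
  rw [h1, h2, add_comm, Finset.sum_sdiff h.1, excess]

theorem numPM_mul [Finite V] (G : SimpleGraph V) {S A : Finset V} (h : IsClosedIn G S A) :
    numPM G S = numPM G A * numPM G (S \ A) := by
  induction hn : A.card using Nat.strong_induction_on generalizing S A with
  | _ n ih =>
    rcases A.eq_empty_or_nonempty with rfl | ⟨v, hv⟩
    · simp [numPM_empty]
    · rw [numPM_expand G (h.1 hv), numPM_expand G hv, h.nb_eq hv, Finset.sum_mul]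
      refine Finset.sum_congr rfl fun w hw => ?_
      obtain ⟨hwS, hvw⟩ := mem_nb.1 hw
      have hwA := h.2 v hv w hwS hvw
      have hcl : IsClosedIn G ((S.erase v).erase w) ((A.erase v).erase w) := by
        refine ⟨Finset.erase_subset_erase _ (Finset.erase_subset_erase _ h.1), ?_⟩
        intro a ha b hb hab
        simp only [Finset.mem_erase] at ha hb ⊢
        exact ⟨hb.1, hb.2.1, h.2 a ha.2.2 b hb.2.2 hab⟩
      have hc1 := Finset.card_erase_add_one hv
      have hc2 := Finset.card_erase_add_one (Finset.mem_erase.2 ⟨hvw.ne', hwA⟩)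
      rw [ih _ (by omega) hcl rfl]
      congr 2
      ext x
      simp only [Finset.mem_sdiff, Finset.mem_erase]
      constructor
      · tauto
      · rintro ⟨h1, h2⟩
        exact ⟨⟨fun h' => h2 (h' ▸ hwA), fun h' => h2 (h' ▸ hv), h1⟩, by tauto⟩

theorem exists_component (G : SimpleGraph V) {S : Finset V} {v : V} (hv : v ∈ S) :
    ∃ A, v ∈ A ∧ IsClosedIn G S A ∧ Conn G A := by
  obtain ⟨A, hA, hmin⟩ := Finset.exists_min_image
    (S.powerset.filter fun A => v ∈ A ∧ IsClosedIn G S A) Finset.card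
    ⟨S, Finset.mem_filter.2 ⟨Finset.mem_powerset_self S, hv, subset_rfl, fun _ _ _ h _ => h⟩⟩
  simp only [Finset.mem_filter, Finset.mem_powerset] at hA hmin
  obtain ⟨hAS, hvA, hcl⟩ := hA
  refine ⟨A, hvA, hcl, ⟨v, hvA⟩, fun B hB hne => ?_⟩
  have hcl' : ∀ B, IsClosedIn G A B → IsClosedIn G S B := fun B hB =>
    ⟨hB.1.trans hAS, fun a ha b hb hab => hB.2 a ha b (hcl.2 a (hB.1 ha) b hb hab) hab⟩
  by_cases hvB : v ∈ B
  · exact Finset.eq_of_subset_of_card_le hB.1 (hmin B ⟨hB.1.trans hAS, hvB, hcl' B hB⟩)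
  -- A closed part missing `v` could be cut off, against the minimality of `A`.
  · have h1 := hmin (A \ B) ⟨Finset.sdiff_subset.trans hAS, by simp [hvA, hvB], hcl' _ hB.compl⟩
    have h2 := Finset.card_sdiff_add_card_eq_card hB.1
    have := hne.card_pos
    omega

theorem component_unique {G : SimpleGraph V} {S A B : Finset V} (hA : IsClosedIn G S A)
    (hB : IsClosedIn G S B) (hA' : Conn G A) (hB' : Conn G B) {v : V} (hvA : v ∈ A)
    (hvB : v ∈ B) : A = B := by
  have hv : (A ∩ B).Nonempty := ⟨v, by simp [hvA, hvB]⟩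
  have h1 : A ∩ B = A := hA'.2 _ ⟨Finset.inter_subset_left, fun a ha b hb hab => by
    simp only [Finset.mem_inter] at ha ⊢
    exact ⟨hb, hB.2 a ha.2 b (hA.1 hb) hab⟩⟩ hv
  have h2 : A ∩ B = B := hB'.2 _ ⟨Finset.inter_subset_right, fun a ha b hb hab => by
    simp only [Finset.mem_inter] at ha ⊢
    exact ⟨hA.2 a ha.1 b (hB.1 hb) hab, hb⟩⟩ hv
  rw [← h1, h2]

/-! ### Edge deletion and `C₄`-free bipartite graphs -/

/-- The graph `G` with the edge `uv` removed. -/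
def del (G : SimpleGraph V) (u v : V) : SimpleGraph V := G.deleteEdges {s(u, v)}

theorem del_adj {G : SimpleGraph V} {u v a b : V} :
    (del G u v).Adj a b ↔ G.Adj a b ∧ ¬(a = u ∧ b = v) ∧ ¬(a = v ∧ b = u) := by
  simp [del, SimpleGraph.deleteEdges_adj]

theorem del_comm (G : SimpleGraph V) (u v : V) : del G u v = del G v u := by
  ext a b; simp only [del_adj]; tauto

theorem nb_del_left {G : SimpleGraph V} (S : Finset V) {u v : V} (h : G.Adj u v) :
    nb (del G u v) S u = (nb G S u).erase v := by
  ext w; simp only [mem_nb, del_adj, Finset.mem_erase]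
  have := h.ne
  tauto

theorem nb_del_right {G : SimpleGraph V} (S : Finset V) {u v : V} (h : G.Adj u v) :
    nb (del G u v) S v = (nb G S v).erase u := by
  rw [del_comm, nb_del_left S h.symm]

theorem nb_del_of_ne {G : SimpleGraph V} (S : Finset V) {u v a : V} (h1 : a ≠ u) (h2 : a ≠ v) :
    nb (del G u v) S a = nb G S a := by
  ext w; simp only [mem_nb, del_adj]; tauto

theorem del_congr {G : SimpleGraph V} {S : Finset V} {u v : V} (h : u ∉ S ∨ v ∉ S) :
    ∀ a ∈ S, ∀ b ∈ S, (del G u v).Adj a b ↔ G.Adj a b := by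
  intro a ha b hb
  rw [del_adj]
  constructor
  · tauto
  · intro hab
    refine ⟨hab, ?_, ?_⟩ <;> rintro ⟨rfl, rfl⟩ <;> tauto

theorem excess_del {G : SimpleGraph V} {S : Finset V} {u v : V} (hu : u ∈ S) (hv : v ∈ S)
    (h : G.Adj u v) : excess (del G u v) S = excess G S - 2 := by
  have h1 := excess_erase G hu
  have h2 := excess_erase (del G u v) hu
  rw [excess_congr (del_congr (G := G) (Or.inl (Finset.notMem_erase u S))), nb_del_left S h] at h2
  have := Finset.card_erase_add_one (mem_nb.2 ⟨hv, h⟩)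
  omega

theorem numPM_del [Finite V] {G : SimpleGraph V} {S : Finset V} {u v : V} (hu : u ∈ S)
    (hv : v ∈ S) (h : G.Adj u v) :
    numPM G S = numPM (del G u v) S + numPM G ((S.erase u).erase v) := by
  rw [numPM_expand G hu, numPM_expand (del G u v) hu, nb_del_left S h,
    ← Finset.sum_erase_add _ _ (mem_nb.2 ⟨hv, h⟩)]
  congr 1
  refine Finset.sum_congr rfl fun w _ => ?_
  exact (numPM_congr (del_congr (by simp))).symm

/-- `G` is bipartite with colour classes given by `col` and has no cycle of length 4. -/
structure Good (col : V → Bool) (G : SimpleGraph V) : Prop where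
  ne : ∀ {u v}, G.Adj u v → col u ≠ col v
  c4 : ∀ {u v a b}, G.Adj u a → G.Adj u b → G.Adj v a → G.Adj v b → u ≠ v → a = b

theorem Good.del {col : V → Bool} {G : SimpleGraph V} (h : Good col G) (u v : V) :
    Good col (del G u v) :=
  ⟨fun h' => h.ne (del_adj.1 h').1, fun h1 h2 h3 h4 =>
    h.c4 (del_adj.1 h1).1 (del_adj.1 h2).1 (del_adj.1 h3).1 (del_adj.1 h4).1⟩

theorem Good.col_eq {col : V → Bool} {G : SimpleGraph V} (h : Good col G) {u v w : V}
    (h1 : G.Adj u w) (h2 : G.Adj w v) : col u = col v := by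
  have := h.ne h1; have := h.ne h2
  cases hu : col u <;> cases hv : col v <;> cases hw : col w <;> simp_all

theorem Good.not_adj {col : V → Bool} {G : SimpleGraph V} (h : Good col G) {u v : V}
    (h1 : col u = col v) : ¬G.Adj u v := fun h' => h.ne h' h1

/-! ### The constants and the weight -/

/-- `α⁻¹ = 2 ^ (-1 / 3)`. -/
noncomputable def ia : ℝ := alpha⁻¹

theorem alpha_pos : 0 < alpha := by unfold alpha; positivity

theorem alpha_pow_three : alpha ^ 3 = 2 := by
  unfold alpha
  rw [← Real.rpow_natCast, ← Real.rpow_mul (by norm_num)]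
  norm_num

theorem ia_pos : 0 < ia := inv_pos.2 alpha_pos

theorem ia_pow_three : ia ^ 3 = 1 / 2 := by
  rw [ia, inv_pow, alpha_pow_three]; norm_num

/-- Since `ia ^ 3 = 1 / 2`, polynomials in `ia` reduce to combinations of `1`, `ia` and `ia ^ 2`.
Decimal bounds for `ia` and `ia ^ 2` therefore settle most later comparisons of constants. -/
theorem ia_gt : 0.7937 < ia := by
  by_contra! h
  have := pow_le_pow_left₀ ia_pos.le h 3
  rw [ia_pow_three] at this
  norm_num at this

theorem ia_lt : ia < 0.79371 := by
  by_contra! h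
  have := pow_le_pow_left₀ (by norm_num) h 3
  rw [ia_pow_three] at this
  norm_num at this

theorem ia_sq_gt : 0.62995 < ia ^ 2 := by nlinarith [ia_gt]
theorem ia_sq_lt : ia ^ 2 < 0.62998 := by nlinarith [ia_lt, ia_pos]
theorem ia_pow_four : ia ^ 4 = ia / 2 := by rw [pow_succ, ia_pow_three]; ring
theorem ia_pow_five : ia ^ 5 = ia ^ 2 / 2 := by
  rw [show ia ^ 5 = ia ^ 3 * ia ^ 2 by ring, ia_pow_three]; ring
theorem ia_pow_six : ia ^ 6 = 1 / 4 := by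
  rw [show ia ^ 6 = ia ^ 3 * ia ^ 3 by ring, ia_pow_three]; ring
theorem ia_pow_seven : ia ^ 7 = ia / 4 := by
  rw [show ia ^ 7 = ia ^ 3 * ia ^ 3 * ia by ring, ia_pow_three]; ring

theorem cOne_eq : cOne = ia ^ 2 + ia ^ 7 := by
  simp only [cOne, ia, inv_pow]; norm_cast

theorem cTwo_eq : cTwo = ia ^ 3 + ia ^ 4 := by
  simp only [cTwo, ia, inv_pow]; norm_cast

theorem cOne_le_cTwo : cOne ≤ cTwo := by
  rw [cOne_eq, cTwo_eq, ia_pow_three, ia_pow_four, ia_pow_seven]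
  linarith [ia_gt, ia_sq_lt]

theorem ia_le_cOne : ia ≤ cOne := by
  rw [cOne_eq, ia_pow_seven]
  linarith [ia_lt, ia_sq_gt]

/-- `α ^ k` where `2 * k` is the excess of `S`. -/
noncomputable def weight (G : SimpleGraph V) (S : Finset V) : ℝ :=
  alpha ^ ((excess G S : ℝ) / 2)

theorem weight_pos (G : SimpleGraph V) (S : Finset V) : 0 < weight G S :=
  Real.rpow_pos_of_pos alpha_pos _

theorem one_lt_alpha : 1 < alpha := by
  by_contra! h
  have := pow_le_one₀ alpha_pos.le h (n := 3)
  rw [alpha_pow_three] at this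
  norm_num at this

theorem ia_pow_eq (j : ℕ) : ia ^ j = alpha ^ (-(j : ℝ)) := by
  rw [Real.rpow_neg alpha_pos.le, Real.rpow_natCast, ia, inv_pow]

theorem weight_le {G H : SimpleGraph V} {S T : Finset V} (j : ℕ)
    (h : excess H T + 2 * j ≤ excess G S) : weight H T ≤ ia ^ j * weight G S := by
  unfold weight
  rw [ia_pow_eq, ← Real.rpow_add alpha_pos]
  apply Real.rpow_le_rpow_of_exponent_le one_lt_alpha.le
  have : ((excess H T + 2 * j : ℤ) : ℝ) ≤ excess G S := by exact_mod_cast h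
  push_cast at this
  linarith

theorem weight_eq {G H : SimpleGraph V} {S T : Finset V} (j : ℕ)
    (h : excess H T + 2 * j = excess G S) : weight H T = ia ^ j * weight G S := by
  unfold weight
  rw [ia_pow_eq, ← Real.rpow_add alpha_pos]
  have : ((excess H T + 2 * j : ℤ) : ℝ) = excess G S := by exact_mod_cast h
  push_cast at this
  congr 1
  linarith

theorem weight_of_excess {G : SimpleGraph V} {S : Finset V} {k : ℤ} (h : excess G S = 2 * k) :
    weight G S = alpha ^ k := by
  rw [weight, h, ← Real.rpow_intCast]
  congr 1; push_cast; ring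

theorem IsClosedIn.weight_mul {G : SimpleGraph V} {S A : Finset V} (h : IsClosedIn G S A) :
    weight G S = weight G A * weight G (S \ A) := by
  unfold weight
  rw [h.excess_add, ← Real.rpow_add alpha_pos]
  congr 1; push_cast; ring

end

/-! ### The exceptional graphs `K₂`, `C₆` and `J` -/

section

variable {V : Type*}

/-- Neighbour table of `K₂`. -/
def tableK : Fin 2 → Finset (Fin 2) := ![{1}, {0}]

/-- Neighbour table of the hexagon. -/
def tableC : Fin 6 → Finset (Fin 6) := ![{1, 5}, {0, 2}, {1, 3}, {2, 4}, {3, 5}, {4, 0}]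

/-- Neighbour table of `graphJ`. -/
def tableJ : Fin 8 → Finset (Fin 8) :=
  ![{1, 5, 6}, {0, 2}, {1, 3}, {2, 4, 7}, {3, 5}, {4, 0}, {0, 7}, {6, 3}]

/-- The graph induced on `S` is isomorphic to the graph with neighbour table `N`. -/
def IsCopy {m : ℕ} (N : Fin m → Finset (Fin m)) (G : SimpleGraph V) (S : Finset V) : Prop :=
  ∃ f : Fin m → V, Function.Injective f ∧ Finset.univ.image f = S ∧
    ∀ i j, G.Adj (f i) (f j) ↔ j ∈ N i

/-- Any two vertices are joined by a walk of length 1 or 2, or by a path of length 3. -/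
def Tight {m : ℕ} (N : Fin m → Finset (Fin m)) : Prop :=
  ∀ i j, (∃ c, c ∈ N i ∧ c ∈ N j) ∨ j ∈ N i ∨
    ∃ c d, c ∈ N i ∧ d ∈ N c ∧ j ∈ N d ∧ c ≠ j ∧ i ≠ d

instance {m : ℕ} (N : Fin m → Finset (Fin m)) : Decidable (Tight N) := by
  unfold Tight; infer_instance

theorem tight_tableK : Tight tableK := by decide
theorem tight_tableC : Tight tableC := by decide
theorem tight_tableJ : Tight tableJ := by decide

/-- An edge beyond those of a tight table would join two vertices of one colour or close a path of
length 3 to a 4-cycle. So an injective homomorphism is already an induced copy. -/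
theorem isCopy_of_hom {m : ℕ} {N : Fin m → Finset (Fin m)} {col : V → Bool}
    {G : SimpleGraph V} {S : Finset V} (hG : Good col G) (hN : Tight N) (f : Fin m → V)
    (hf : Function.Injective f) (hS : Finset.univ.image f = S)
    (h : ∀ i, ∀ j ∈ N i, G.Adj (f i) (f j)) : IsCopy N G S := by
  refine ⟨f, hf, hS, fun i j => ⟨fun hij => ?_, h i j⟩⟩
  rcases hN i j with ⟨c, hi, hj⟩ | h1 | ⟨c, d, hc, hd, hj, hne, hne'⟩
  · exact absurd hij (hG.not_adj (hG.col_eq (h i c hi) (h j c hj).symm))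
  · exact h1
  · exact absurd (hf (hG.c4 (h i c hc) hij (h c d hd).symm (h d j hj) (hf.ne hne'))) hne

theorem copy_nb {m : ℕ} {N : Fin m → Finset (Fin m)} {G : SimpleGraph V} {S : Finset V}
    {f : Fin m → V} (hS : Finset.univ.image f = S)
    (h : ∀ i j, G.Adj (f i) (f j) ↔ j ∈ N i) (i : Fin m) : nb G S (f i) = (N i).image f := by
  ext w
  simp only [mem_nb, ← hS, Finset.mem_image, Finset.mem_univ, true_and]
  constructor
  · rintro ⟨⟨j, rfl⟩, hj⟩; exact ⟨j, (h i j).1 hj, rfl⟩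
  · rintro ⟨j, hj, rfl⟩; exact ⟨⟨j, rfl⟩, (h i j).2 hj⟩

theorem copy_card_nb {m : ℕ} {N : Fin m → Finset (Fin m)} {G : SimpleGraph V} {S : Finset V}
    {f : Fin m → V} (hf : Function.Injective f) (hS : Finset.univ.image f = S)
    (h : ∀ i j, G.Adj (f i) (f j) ↔ j ∈ N i) (i : Fin m) :
    (nb G S (f i)).card = (N i).card := by
  rw [copy_nb hS h, Finset.card_image_of_injective _ hf]

theorem IsCopy.excess {m : ℕ} {N : Fin m → Finset (Fin m)} {G : SimpleGraph V} {S : Finset V}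
    (h : IsCopy N G S) : excess G S = ∑ i, (((N i).card : ℤ) - 1) := by
  obtain ⟨f, hf, hS, h⟩ := h
  have : C4Free.excess G S = ∑ v ∈ Finset.univ.image f, (((nb G S v).card : ℤ) - 1) := by
    rw [hS]; rfl
  rw [this, Finset.sum_image fun a _ b _ hab => hf hab]
  exact Finset.sum_congr rfl fun i _ => by rw [copy_card_nb hf hS h]

theorem IsCopy.common {m : ℕ} {N : Fin m → Finset (Fin m)} {col : V → Bool}
    {G : SimpleGraph V} {S : Finset V} (hG : Good col G) (hN : Tight N) (h : IsCopy N G S)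
    {a b : V} (ha : a ∈ S) (hb : b ∈ S) (hab : col a = col b) :
    ∃ z ∈ S, G.Adj a z ∧ G.Adj b z := by
  obtain ⟨f, hf, hS, h⟩ := h
  subst hS
  simp only [Finset.mem_image, Finset.mem_univ, true_and] at ha hb
  obtain ⟨i, rfl⟩ := ha
  obtain ⟨j, rfl⟩ := hb
  rcases hN i j with ⟨c, hi, hj⟩ | h1 | ⟨c, d, hc, hd, hj, hne, hne'⟩
  · exact ⟨f c, by simp, (h _ _).2 hi, (h _ _).2 hj⟩
  · exact absurd ((h _ _).2 h1) (hG.not_adj hab)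
  · have h1 := hG.col_eq ((h _ _).2 hc) ((h _ _).2 hd)
    exact absurd ((h _ _).2 hj) (hG.not_adj (h1.symm.trans hab))

/-- The graph induced on `S` is `K₂`, the hexagon or `graphJ`. -/
def Exc (G : SimpleGraph V) (S : Finset V) : Prop :=
  IsCopy tableK G S ∨ IsCopy tableC G S ∨ IsCopy tableJ G S

theorem Exc.common {col : V → Bool} {G : SimpleGraph V} {S : Finset V} (hG : Good col G)
    (h : Exc G S) {a b : V} (ha : a ∈ S) (hb : b ∈ S) (hab : col a = col b) :
    ∃ z ∈ S, G.Adj a z ∧ G.Adj b z := by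
  rcases h with h | h | h
  · exact h.common hG tight_tableK ha hb hab
  · exact h.common hG tight_tableC ha hb hab
  · exact h.common hG tight_tableJ ha hb hab

/-- Two neighbours of `w` have the same colour, hence a common neighbour inside `S`; with `w` it
would complete a 4-cycle. -/
theorem Exc.eq_of_adj {col : V → Bool} {G : SimpleGraph V} {S : Finset V} (hG : Good col G)
    (h : Exc G S) {w a b : V} (hw : w ∉ S) (ha : a ∈ S) (hb : b ∈ S) (hwa : G.Adj w a)
    (hwb : G.Adj w b) : a = b := by
  obtain ⟨z, hz, h1, h2⟩ := h.common hG ha hb (hG.col_eq hwa.symm hwb)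
  exact hG.c4 hwa hwb h1.symm h2.symm fun h' => hw (h' ▸ hz)

theorem excess_tableK {G : SimpleGraph V} {S : Finset V} (h : IsCopy tableK G S) :
    excess G S = 0 := by rw [h.excess]; decide

theorem excess_tableC {G : SimpleGraph V} {S : Finset V} (h : IsCopy tableC G S) :
    excess G S = 6 := by rw [h.excess]; decide

theorem excess_tableJ {G : SimpleGraph V} {S : Finset V} (h : IsCopy tableJ G S) :
    excess G S = 10 := by rw [h.excess]; decide

theorem card_nb_tableK {G : SimpleGraph V} {S : Finset V} (h : IsCopy tableK G S) {v : V}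
    (hv : v ∈ S) : (nb G S v).card = 1 := by
  obtain ⟨f, hf, rfl, h⟩ := h
  obtain ⟨i, -, rfl⟩ := Finset.mem_image.1 hv
  rw [copy_card_nb hf rfl h]
  clear hv; revert i; decide

theorem card_nb_tableC {G : SimpleGraph V} {S : Finset V} (h : IsCopy tableC G S) {v : V}
    (hv : v ∈ S) : (nb G S v).card = 2 := by
  obtain ⟨f, hf, rfl, h⟩ := h
  obtain ⟨i, -, rfl⟩ := Finset.mem_image.1 hv
  rw [copy_card_nb hf rfl h]
  clear hv; revert i; decide

/-- Exceptional graphs have vertices of small degree. -/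
theorem Exc.low {col : V → Bool} {G : SimpleGraph V} {S : Finset V} (hG : Good col G)
    (h : Exc G S) : (∃ a ∈ S, (nb G S a).card ≤ 1) ∨ ∃ a ∈ S, ∃ b ∈ S, a ≠ b ∧
      col a = col b ∧ (nb G S a).card ≤ 2 ∧ (nb G S b).card ≤ 2 := by
  rcases h with ⟨f, hf, hS, h⟩ | ⟨f, hf, hS, h⟩ | ⟨f, hf, hS, h⟩
  · left
    refine ⟨f 0, by simp [← hS], ?_⟩
    rw [copy_card_nb hf hS h]; decide
  · right
    refine ⟨f 1, by simp [← hS], f 3, by simp [← hS], hf.ne (by decide),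
      hG.col_eq ((h 1 2).2 (by decide)) ((h 2 3).2 (by decide)), ?_, ?_⟩ <;>
    · rw [copy_card_nb hf hS h]; decide
  · right
    refine ⟨f 2, by simp [← hS], f 4, by simp [← hS], hf.ne (by decide),
      hG.col_eq ((h 2 3).2 (by decide)) ((h 3 4).2 (by decide)), ?_, ?_⟩ <;>
    · rw [copy_card_nb hf hS h]; decide

/-! ### The simultaneous induction, and cut edges -/

/-- The measure used for the induction. -/
noncomputable def size (G : SimpleGraph V) (S : Finset V) : ℕ :=
  S.card + ∑ v ∈ S, (nb G S v).card

theorem size_lt {G : SimpleGraph V} {S T : Finset V} (h : T ⊂ S) : size G T < size G S := by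
  have h1 := Finset.card_lt_card h
  have h2 : ∑ v ∈ T, (nb G T v).card ≤ ∑ v ∈ S, (nb G S v).card :=
    (Finset.sum_le_sum fun v _ => Finset.card_le_card
      (Finset.filter_subset_filter _ h.subset)).trans
      (Finset.sum_le_sum_of_subset h.subset)
  unfold size; omega

theorem size_del_lt {G : SimpleGraph V} {S : Finset V} {u v : V} (hu : u ∈ S) (hv : v ∈ S)
    (h : G.Adj u v) : size (del G u v) S < size G S := by
  unfold size
  refine Nat.add_lt_add_left (Finset.sum_lt_sum (fun a _ => Finset.card_le_card ?_)
    ⟨u, hu, ?_⟩) _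
  · intro w; simp only [mem_nb, del_adj]; tauto
  · rw [nb_del_left S h]
    exact Finset.card_erase_lt_of_mem (mem_nb.2 ⟨hv, h⟩)

theorem size_mono {G : SimpleGraph V} {S T : Finset V} (h : T ⊆ S) : size G T ≤ size G S := by
  rcases h.eq_or_ssubset with rfl | h
  · rfl
  · exact (size_lt h).le

/-- The three bounds of the theorem for the graph induced on `S`. -/
structure Holds (G : SimpleGraph V) (S : Finset V) : Prop where
  a : (numPM G S : ℝ) ≤ weight G S
  b : Conn G S → (∃ v ∈ S, (nb G S v).card ≤ 2) → (∀ v ∈ S, (nb G S v).card ≤ 3) → ¬Exc G S →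
    (numPM G S : ℝ) ≤ cOne * weight G S
  c : Conn G S → (∃ v ∈ S, (nb G S v).card ≤ 2) → ¬Exc G S →
    (numPM G S : ℝ) ≤ cTwo * weight G S

/-- The induction hypothesis for the graph induced on `S`. -/
def IH (col : V → Bool) (G : SimpleGraph V) (S : Finset V) : Prop :=
  ∀ H T, Good col H → size H T < size G S → Holds H T

theorem IH.le {col : V → Bool} {G : SimpleGraph V} {S T : Finset V} (h : IH col G S)
    (hG : Good col G) (hT : T ⊂ S) : (numPM G T : ℝ) ≤ weight G T :=
  (h G T hG (size_lt hT)).a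

theorem ssubset_of_erase {S T : Finset V} {v : V} (hv : v ∈ S) (h : T ⊆ S.erase v) : T ⊂ S :=
  lt_of_le_of_lt h (Finset.erase_ssubset hv)

/-- Two vertices and `d(u) + d(v) - 1` edges disappear, as `uv` lies at both ends. -/
theorem excess_pair {G : SimpleGraph V} {S : Finset V} {u v : V} (hv : v ∈ S)
    (hu : u ∈ nb G S v) : excess G ((S.erase v).erase u) =
      excess G S - 2 * ((nb G S v).card + (nb G S u).card - 2) := by
  obtain ⟨hu', h⟩ := mem_nb.1 hu
  rw [excess_erase G (Finset.mem_erase.2 ⟨h.ne', hu'⟩), excess_erase G hv, nb_erase]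
  have := Finset.card_erase_add_one (mem_nb.2 ⟨hv, h.symm⟩)
  omega

/-- If a bound holds for a component, then it holds for the whole graph. -/
theorem le_of_component [Finite V] {G : SimpleGraph V} {S A : Finset V} {c : ℝ}
    (hA : IsClosedIn G S A) (h1 : (numPM G A : ℝ) ≤ c * weight G A)
    (h2 : (numPM G (S \ A) : ℝ) ≤ weight G (S \ A)) : (numPM G S : ℝ) ≤ c * weight G S := by
  rw [numPM_mul G hA, hA.weight_mul]
  push_cast
  calc (numPM G A : ℝ) * numPM G (S \ A) ≤ (c * weight G A) * weight G (S \ A) :=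
        mul_le_mul h1 h2 (by positivity) ((Nat.cast_nonneg _).trans h1)
    _ = _ := by ring

/-- `A` and `A.erase u` have different parities, so at most one of them can be perfectly matched.
Hence the perfect matchings all contain `uv` or all avoid it, and either its two ends or the edge
itself can be removed without loss. Both lower `k` by at least 1; the degree hypothesis serves the
removal of the ends. -/
theorem bridge [Finite V] {col : V → Bool} {G : SimpleGraph V} {S A : Finset V} (hG : Good col G)
    (hI : IH col G S) (hA : A ⊆ S) {u v : V} (hu : u ∈ A) (hv : v ∈ S) (hvA : v ∉ A)
    (huv : G.Adj u v) (hdeg : 3 ≤ (nb G S u).card + (nb G S v).card)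
    (hcut : ∀ a ∈ A, ∀ b ∈ S, b ∉ A → G.Adj a b → a = u ∧ b = v) :
    (numPM G S : ℝ) ≤ ia * weight G S := by
  have huS := hA hu
  have hsplit := numPM_del huS hv huv
  have hcl : IsClosedIn (del G u v) S A := by
    refine ⟨hA, fun a ha b hb hab => ?_⟩
    rw [del_adj] at hab
    by_contra hbA
    exact hab.2.1 (hcut a ha b hb hbA hab.1)
  have hcl' : IsClosedIn G ((S.erase u).erase v) (A.erase u) := by
    refine ⟨fun a ha => ?_, fun a ha b hb hab => ?_⟩
    · simp only [Finset.mem_erase] at ha ⊢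
      exact ⟨fun h => hvA (h ▸ ha.2), ha.1, hA ha.2⟩
    · simp only [Finset.mem_erase] at ha hb ⊢
      by_contra hbA
      exact ha.1 (hcut a ha.2 b hb.2.2 (fun h => hbA ⟨hb.2.1, h⟩) hab).1
  by_cases h0 : numPM (del G u v) A = 0
  · rw [numPM_mul _ hcl, h0, zero_mul, zero_add] at hsplit
    rw [hsplit]
    refine (hI.le hG (ssubset_of_erase huS (Finset.erase_subset _ _))).trans ?_
    have := weight_le (G := G) (S := S) (H := G) (T := (S.erase u).erase v) 1
      (by rw [excess_pair huS (mem_nb.2 ⟨hv, huv⟩)]; push_cast; omega)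
    simpa using this
  · have h1 : numPM G (A.erase u) = 0 := by
      by_contra h2
      have h3 := even_card_of_numPM_ne_zero _ _ h0
      have h4 := even_card_of_numPM_ne_zero _ _ h2
      have h5 := Finset.card_erase_add_one hu
      rw [← h5] at h3
      rcases h3 with ⟨m, hm⟩
      rcases h4 with ⟨l, hl⟩
      omega
    rw [numPM_mul _ hcl', h1, zero_mul, add_zero] at hsplit
    rw [hsplit]
    refine (hI _ S (hG.del u v) (size_del_lt huS hv huv)).a.trans ?_
    have := weight_le (G := G) (S := S) (H := del G u v) (T := S) 1
      (by rw [excess_del huS hv huv]; push_cast; omega)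
    simpa using this

end

/-! ### Expansion along chains of vertices of degree 2 -/

section

variable {V : Type*}

theorem nb_erase_of_not_adj {G : SimpleGraph V} {S : Finset V} {v w : V} (h : ¬G.Adj w v) :
    nb G (S.erase v) w = nb G S w := by
  rw [nb_erase, Finset.erase_eq_of_notMem fun h' => h (mem_nb.1 h').2]

theorem left_mem_of_nb {G : SimpleGraph V} {S : Finset V} {v a b : V} (h : nb G S v = {a, b}) :
    a ∈ S ∧ G.Adj v a := mem_nb.1 (by rw [h]; simp)

theorem right_mem_of_nb {G : SimpleGraph V} {S : Finset V} {v a b : V} (h : nb G S v = {a, b}) :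
    b ∈ S ∧ G.Adj v b := mem_nb.1 (by rw [h]; simp)

theorem pair_erase_left {a b : V} (h : a ≠ b) : ({a, b} : Finset V).erase a = {b} := by
  ext z; simp; grind

theorem pair_erase_right {a b : V} (h : a ≠ b) : ({a, b} : Finset V).erase b = {a} := by
  ext z; simp; grind

variable {col : V → Bool} {G : SimpleGraph V} {S : Finset V}

theorem le_add_of_excess (hI : IH col G S) (hG : Good col G) {T₁ T₂ : Finset V} (h₁ : T₁ ⊂ S)
    (h₂ : T₂ ⊂ S) (h : numPM G S = numPM G T₁ + numPM G T₂) (i j : ℕ)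
    (hi : excess G T₁ + 2 * i ≤ excess G S) (hj : excess G T₂ + 2 * j ≤ excess G S) :
    (numPM G S : ℝ) ≤ (ia ^ i + ia ^ j) * weight G S := by
  rw [h, add_mul]
  push_cast
  exact add_le_add ((hI.le hG h₁).trans (weight_le i hi)) ((hI.le hG h₂).trans (weight_le j hj))

variable [Finite V]

theorem leaf_excess {v u : V} (hv : v ∈ S) (h : nb G S v = {u}) :
    numPM G S = numPM G ((S.erase v).erase u) ∧
      excess G ((S.erase v).erase u) = excess G S - 2 * ((nb G S u).card - 1) := by
  refine ⟨numPM_leaf hv h, ?_⟩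
  rw [excess_pair hv (by rw [h]; simp), h, Finset.card_singleton]
  push_cast; ring

/-- Two adjacent vertices of degree 2. -/
theorem two_chain (hG : Good col G) {x a b y : V} (ha : nb G S a = {x, b})
    (hb : nb G S b = {a, y}) (hxb : x ≠ b) (hay : a ≠ y) :
    numPM G S = numPM G ((S.erase a).erase b) +
        numPM G ((((S.erase a).erase x).erase b).erase y) ∧
      excess G ((S.erase a).erase b) = excess G S - 4 ∧
      excess G ((((S.erase a).erase x).erase b).erase y) =
        excess G S - 2 * ((nb G S x).card + (nb G S y).card - 1) := by
  obtain ⟨hxS, hax⟩ := left_mem_of_nb ha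
  obtain ⟨hbS, hab⟩ := right_mem_of_nb ha
  obtain ⟨haS, -⟩ := left_mem_of_nb hb
  obtain ⟨hyS, hby⟩ := right_mem_of_nb hb
  have hcx : col x = col b := hG.col_eq hax.symm hab
  have hcy : col a = col y := hG.col_eq hab hby
  -- An edge `xy` would close the 4-cycle `x a b y`, so removing `x` leaves the degree of `y`
  -- intact.
  have hyx : ¬G.Adj y x := fun h => hay (hG.c4 hax.symm h.symm hab.symm hby hxb)
  -- Matching `a` with `x` forces `b` onto `y`.
  have h1 : nb G ((S.erase a).erase x) b = {y} := by
    rw [nb_erase_of_not_adj (hG.not_adj hcx.symm), nb_erase, hb, pair_erase_left hay]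
  have h2 := leaf_excess (G := G) (S := (S.erase a).erase x) (v := b) (u := y)
    (by simp [hbS, hab.ne', hxb.symm]) h1
  rw [nb_erase_of_not_adj hyx, nb_erase_of_not_adj (hG.not_adj hcy.symm)] at h2
  have h3 := excess_pair (G := G) haS (mem_nb.2 ⟨hxS, hax⟩)
  have h4 := excess_pair (G := G) haS (mem_nb.2 ⟨hbS, hab⟩)
  have h5 : (nb G S a).card = 2 := by rw [ha, Finset.card_pair hxb]
  have h6 : (nb G S b).card = 2 := by rw [hb, Finset.card_pair hay]
  refine ⟨?_, ?_, ?_⟩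
  · rw [numPM_pair haS ha hxb, h2.1, add_comm]
  · rw [h4, h5, h6]; norm_num
  · rw [h2.2, h3, h5]; push_cast; ring

/-- One half of the expansion at the middle vertex of three consecutive vertices of degree 2. -/
theorem three_chain_aux (hG : Good col G) {x a b c y : V} (ha : nb G S a = {x, b})
    (hb : nb G S b = {a, c}) (hc : nb G S c = {b, y}) (hxb : x ≠ b) (hac : a ≠ c)
    (hby : b ≠ y) :
    ∃ T ⊂ S, numPM G ((S.erase b).erase a) = numPM G T ∧
      excess G T = excess G S - 2 * ((nb G S y).card + 1) := by
  obtain ⟨hxS, hax⟩ := left_mem_of_nb ha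
  obtain ⟨hbS, hab⟩ := right_mem_of_nb ha
  obtain ⟨haS, -⟩ := left_mem_of_nb hb
  obtain ⟨hcS, hbc⟩ := right_mem_of_nb hb
  obtain ⟨hyS, hcy⟩ := right_mem_of_nb hc
  have hca : col a = col c := hG.col_eq hab hbc
  have hcb : col b = col y := hG.col_eq hbc hcy
  have hay : ¬G.Adj y a := fun h => by
    have : y ∈ nb G S a := mem_nb.2 ⟨hyS, h.symm⟩
    rw [ha] at this
    simp only [Finset.mem_insert, Finset.mem_singleton] at this
    rcases this with rfl | rfl
    · exact hby (hG.c4 hab hax hbc.symm hcy hac)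
    · exact hby rfl
  -- Matching `b` with `a` forces `c` onto `y`.
  have h1 : nb G ((S.erase b).erase a) c = {y} := by
    rw [nb_erase_of_not_adj (hG.not_adj hca.symm), nb_erase, hc, pair_erase_left hby]
  have h2 := leaf_excess (G := G) (S := (S.erase b).erase a) (v := c) (u := y)
    (by simp [hcS, hac.symm, hbc.ne']) h1
  rw [nb_erase_of_not_adj hay, nb_erase_of_not_adj (hG.not_adj hcb.symm)] at h2
  have h3 := excess_pair (G := G) hbS (mem_nb.2 ⟨haS, hab.symm⟩)
  rw [show (nb G S a).card = 2 by rw [ha, Finset.card_pair hxb],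
    show (nb G S b).card = 2 by rw [hb, Finset.card_pair hac]] at h3
  refine ⟨_, ssubset_of_erase hbS ?_, h2.1, ?_⟩
  · exact (Finset.erase_subset _ _).trans ((Finset.erase_subset _ _).trans
      (Finset.erase_subset _ _))
  · rw [h2.2, h3]; push_cast; ring

theorem three_chain (hG : Good col G) (hI : IH col G S) {x a b c y : V}
    (ha : nb G S a = {x, b}) (hb : nb G S b = {a, c}) (hc : nb G S c = {b, y}) (hxb : x ≠ b)
    (hac : a ≠ c) (hby : b ≠ y) (i j : ℕ) (hi : i ≤ (nb G S x).card)
    (hj : j ≤ (nb G S y).card) :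
    (numPM G S : ℝ) ≤ (ia ^ (j + 1) + ia ^ (i + 1)) * weight G S := by
  obtain ⟨T₁, h1, h2, h3⟩ := three_chain_aux hG ha hb hc hxb hac hby
  obtain ⟨T₂, h4, h5, h6⟩ := three_chain_aux hG (by rw [hc, Finset.pair_comm])
    (by rw [hb, Finset.pair_comm]) (by rw [ha, Finset.pair_comm]) hby.symm hac.symm hxb.symm
  refine le_add_of_excess hI hG h1 h4 ?_ (j + 1) (i + 1) ?_ ?_
  · rw [numPM_pair (left_mem_of_nb hc).1 hb hac, h2, h5]
  · rw [h3]; push_cast; omega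
  · rw [h6]; push_cast; omega

/-- Four consecutive vertices of degree 2. -/
theorem four_chain (hG : Good col G) {x a b c d y : V} (ha : nb G S a = {x, b})
    (hb : nb G S b = {a, c}) (hc : nb G S c = {b, d}) (hd : nb G S d = {c, y}) (hxb : x ≠ b)
    (hac : a ≠ c) (hbd : b ≠ d) (hcy : c ≠ y) :
    numPM G S = numPM G ((((S.erase b).erase a).erase c).erase d) +
        numPM G ((((((S.erase b).erase c).erase a).erase x).erase d).erase y) ∧
      excess G ((((S.erase b).erase a).erase c).erase d) = excess G S - 6 ∧
      excess G ((((((S.erase b).erase c).erase a).erase x).erase d).erase y) =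
        excess G S - 2 * ((nb G S x).card + (nb G S y).card - if G.Adj x y then 1 else 0) := by
  obtain ⟨hxS, hax⟩ := left_mem_of_nb ha
  obtain ⟨hbS, hab⟩ := right_mem_of_nb ha
  obtain ⟨haS, -⟩ := left_mem_of_nb hb
  obtain ⟨hcS, hbc⟩ := right_mem_of_nb hb
  obtain ⟨hdS, hcd⟩ := right_mem_of_nb hc
  obtain ⟨hyS, hdy⟩ := right_mem_of_nb hd
  have c1 : col x = col b := hG.col_eq hax.symm hab
  have c2 : col a = col c := hG.col_eq hab hbc
  have c3 : col b = col d := hG.col_eq hbc hcd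
  have c4 : col c = col y := hG.col_eq hcd hdy
  have hxd : x ≠ d := by
    rintro rfl
    exact hac (hG.c4 hax.symm hcd.symm hab.symm hbc hxb)
  have hya : y ≠ a := by
    rintro rfl
    exact hbd (hG.c4 hab hdy.symm hbc.symm hcd hac)
  have da : (nb G S a).card = 2 := by rw [ha, Finset.card_pair hxb]
  have db : (nb G S b).card = 2 := by rw [hb, Finset.card_pair hac]
  have dc : (nb G S c).card = 2 := by rw [hc, Finset.card_pair hbd]
  have dd : (nb G S d).card = 2 := by rw [hd, Finset.card_pair hcy]
  have nad : ¬G.Adj d a := fun h => by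
    have : a ∈ nb G S d := mem_nb.2 ⟨haS, h⟩
    rw [hd] at this
    simp only [Finset.mem_insert, Finset.mem_singleton] at this
    grind
  have nxc : ¬G.Adj x c := fun h => by
    have : x ∈ nb G S c := mem_nb.2 ⟨hxS, h.symm⟩
    rw [hc] at this
    simp only [Finset.mem_insert, Finset.mem_singleton] at this
    grind
  have nyb : ¬G.Adj y b := fun h => by
    have : y ∈ nb G S b := mem_nb.2 ⟨hyS, h.symm⟩
    rw [hb] at this
    simp only [Finset.mem_insert, Finset.mem_singleton] at this
    grind
  have hba := excess_pair (G := G) hbS (mem_nb.2 ⟨haS, hab.symm⟩)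
  have hbc' := excess_pair (G := G) hbS (mem_nb.2 ⟨hcS, hbc⟩)
  -- Matching `b` with `a` forces `cd`; matching `b` with `c` forces `ax` and `dy`.
  have h1 := leaf_excess (G := G) (S := (S.erase b).erase a) (v := c) (u := d)
    (by simp [hcS, hac.symm, hbc.ne'])
    (by rw [nb_erase_of_not_adj (hG.not_adj c2.symm), nb_erase, hc, pair_erase_left hbd])
  rw [nb_erase_of_not_adj nad, nb_erase_of_not_adj (hG.not_adj c3.symm), dd] at h1
  have h2 := leaf_excess (G := G) (S := (S.erase b).erase c) (v := a) (u := x)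
    (by simp [haS, hac, hab.ne])
    (by rw [nb_erase_of_not_adj (hG.not_adj c2), nb_erase, ha, pair_erase_right hxb])
  rw [nb_erase_of_not_adj nxc, nb_erase_of_not_adj (hG.not_adj c1)] at h2
  have hyx : y ≠ x := fun h => by
    subst h; exact (hG.ne hab) (by rw [c2, c4, c1])
  have h3 := leaf_excess (G := G) (S := (((S.erase b).erase c).erase a).erase x) (v := d) (u := y)
    (by simp [hdS, hxd.symm, hbd.symm, hcd.ne']; rintro rfl; exact hG.ne hab (by rw [c3]))
    (by rw [nb_erase_of_not_adj (hG.not_adj (by rw [← c3, c1])), nb_erase_of_not_adj nad,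
          nb_erase, nb_erase_of_not_adj (hG.not_adj c3.symm), hd, pair_erase_left hcy])
  -- Here `x` and `y` may be adjacent: the chain then closes to a hexagon, and `y` loses one
  -- neighbour with `x`.
  have h4 : ((nb G ((((S.erase b).erase c).erase a).erase x) y).card : ℤ) =
      (nb G S y).card - if G.Adj x y then 1 else 0 := by
    rw [nb_erase, nb_erase_of_not_adj (hG.not_adj (by rw [← c4, c2])),
      nb_erase_of_not_adj (hG.not_adj c4.symm), nb_erase_of_not_adj nyb]
    split_ifs with h
    · have := Finset.card_erase_add_one (mem_nb.2 ⟨hxS, h.symm⟩)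
      omega
    · rw [Finset.erase_eq_of_notMem fun h' => h (mem_nb.1 h').2.symm]; ring
  refine ⟨?_, ?_, ?_⟩
  · rw [numPM_pair hbS hb hac, h1.1, h2.1, h3.1]
  · rw [h1.2, hba, da, db]; norm_num; ring
  · rw [h3.2, h4, h2.2, hbc', db, dc]; push_cast; ring

end

/-! ### Recognising exceptional graphs; leaves and long chains -/

section

variable {V : Type*} {col : V → Bool} {G : SimpleGraph V} {S : Finset V}

theorem copyK_of_adj (hG : Good col G) {u v : V} (h : G.Adj u v) (hS : S = {u, v}) :
    IsCopy tableK G S := by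
  refine isCopy_of_hom hG tight_tableK ![u, v] ?_ ?_ ?_
  · rw [← List.nodup_ofFn]; simpa using h.ne
  · subst hS; ext z; simp [Fin.exists_fin_two, eq_comm]
  · intro i
    fin_cases i <;> simp [tableK, h, h.symm]

theorem copyC_of_adj (hG : Good col G) {x a b c d y : V} (h₁ : G.Adj x a) (h₂ : G.Adj a b)
    (h₃ : G.Adj b c) (h₄ : G.Adj c d) (h₅ : G.Adj d y) (h₆ : G.Adj y x) (n₁ : x ≠ b)
    (n₂ : b ≠ d) (n₃ : x ≠ d) (n₄ : a ≠ c) (n₅ : c ≠ y) (n₆ : a ≠ y)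
    (hS : ∀ z, z ∈ S ↔ z = x ∨ z = a ∨ z = b ∨ z = c ∨ z = d ∨ z = y) : IsCopy tableC G S := by
  have hinj : Function.Injective ![x, a, b, c, d, y] := by
    have k₁ := hG.ne h₁
    have k₂ := hG.col_eq h₁ h₂
    have k₃ := hG.col_eq h₂ h₃
    have k₄ := hG.col_eq h₃ h₄
    have k₅ := hG.col_eq h₄ h₅
    clear hS
    rw [← List.nodup_ofFn]
    simp
    grind
  refine isCopy_of_hom hG tight_tableC _ hinj ?_ ?_
  · ext z; simp [Fin.exists_fin_succ, eq_comm, hS]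
  · intro i
    have := h₁.symm; have := h₂.symm; have := h₃.symm
    have := h₄.symm; have := h₅.symm; have := h₆.symm
    fin_cases i <;> simp [tableC, *]

theorem copyJ_of_adj (hG : Good col G) {x a b y c d e f : V} (h₁ : G.Adj x a) (h₂ : G.Adj a b)
    (h₃ : G.Adj b y) (h₄ : G.Adj y c) (h₅ : G.Adj c d) (h₆ : G.Adj d x) (h₇ : G.Adj x e)
    (h₈ : G.Adj e f) (h₉ : G.Adj f y) (n₁ : x ≠ b) (n₂ : x ≠ c) (n₃ : x ≠ f)
    (n₄ : b ≠ c) (n₅ : b ≠ f) (n₆ : c ≠ f) (n₇ : y ≠ a) (n₈ : y ≠ d) (n₉ : y ≠ e)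
    (n₁₀ : a ≠ d) (n₁₁ : a ≠ e) (n₁₂ : d ≠ e)
    (hS : ∀ z, z ∈ S ↔ z = x ∨ z = a ∨ z = b ∨ z = y ∨ z = c ∨ z = d ∨ z = e ∨ z = f) :
    IsCopy tableJ G S := by
  have hinj : Function.Injective ![x, a, b, y, c, d, e, f] := by
    have k₁ := hG.ne h₁
    have k₂ := hG.col_eq h₁ h₂
    have k₃ := hG.col_eq h₂ h₃
    have k₄ := hG.col_eq h₃ h₄
    have k₅ := hG.col_eq h₄ h₅
    have k₆ := hG.col_eq h₇ h₈
    have k₇ := hG.col_eq h₈ h₉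
    clear hS
    rw [← List.nodup_ofFn]
    simp [not_or]
    and_intros <;> grind
  refine isCopy_of_hom hG tight_tableJ _ hinj ?_ ?_
  · ext z; simp [Fin.exists_fin_succ, eq_comm, hS]
  · intro i
    have := h₁.symm; have := h₂.symm; have := h₃.symm
    have := h₄.symm; have := h₅.symm; have := h₆.symm
    have := h₇.symm; have := h₈.symm; have := h₉.symm
    fin_cases i <;> simp [tableJ, *]

theorem hexagon_of_nb (hG : Good col G) (hS : Conn G S) {x a b c d y : V}
    (hx : nb G S x = {a, y}) (ha : nb G S a = {x, b}) (hb : nb G S b = {a, c})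
    (hc : nb G S c = {b, d}) (hd : nb G S d = {c, y}) (hy : nb G S y = {d, x}) (n₁ : x ≠ b)
    (n₂ : b ≠ d) (n₃ : x ≠ d) (n₄ : a ≠ c) (n₅ : c ≠ y) (n₆ : a ≠ y) : IsCopy tableC G S := by
  have hcl : ({x, a, b, c, d, y} : Finset V) = S := by
    refine hS.2 _ ⟨?_, ?_⟩ ⟨x, by simp⟩
    · intro w hw
      simp only [Finset.mem_insert, Finset.mem_singleton] at hw
      rcases hw with rfl | rfl | rfl | rfl | rfl | rfl
      exacts [(left_mem_of_nb ha).1, (left_mem_of_nb hx).1, (right_mem_of_nb ha).1,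
        (right_mem_of_nb hb).1, (right_mem_of_nb hc).1, (right_mem_of_nb hd).1]
    · intro u hu w hw huw
      have hw' : w ∈ nb G S u := mem_nb.2 ⟨hw, huw⟩
      rw [Finset.mem_insert, Finset.mem_insert, Finset.mem_insert, Finset.mem_insert,
        Finset.mem_insert, Finset.mem_singleton] at hu
      rcases hu with rfl | rfl | rfl | rfl | rfl | rfl
      on_goal 1 => rw [hx] at hw'
      on_goal 2 => rw [ha] at hw'
      on_goal 3 => rw [hb] at hw'
      on_goal 4 => rw [hc] at hw'
      on_goal 5 => rw [hd] at hw'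
      on_goal 6 => rw [hy] at hw'
      all_goals
        rw [Finset.mem_insert, Finset.mem_singleton] at hw'
        rcases hw' with rfl | rfl <;> simp
  exact copyC_of_adj hG (left_mem_of_nb hx).2 (right_mem_of_nb ha).2 (right_mem_of_nb hb).2
    (right_mem_of_nb hc).2 (right_mem_of_nb hd).2 (right_mem_of_nb hy).2 n₁ n₂ n₃ n₄ n₅ n₆
    fun w => by rw [← hcl]; simp

/-- The bounds for connected graphs with a vertex of degree at most 2, where `D` says that the
maximum degree is at most 3. -/
def Bnd (G : SimpleGraph V) (S : Finset V) (D : Prop) : Prop :=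
  (numPM G S : ℝ) ≤ cTwo * weight G S ∧ (D → (numPM G S : ℝ) ≤ cOne * weight G S)

theorem Bnd.of_le {D : Prop} {c : ℝ} (hc : c ≤ cOne) (h : (numPM G S : ℝ) ≤ c * weight G S) :
    Bnd G S D := by
  have h1 := h.trans (mul_le_mul_of_nonneg_right hc (weight_pos G S).le)
  exact ⟨h1.trans (mul_le_mul_of_nonneg_right cOne_le_cTwo (weight_pos G S).le), fun _ => h1⟩

theorem eq_pair_of_card {v a : V} (h : (nb G S v).card = 2) (ha : a ∈ nb G S v) :
    ∃ b, nb G S v = {a, b} ∧ a ≠ b := by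
  obtain ⟨z, hz⟩ := Finset.card_eq_one.1
    (show ((nb G S v).erase a).card = 1 by rw [Finset.card_erase_of_mem ha, h])
  refine ⟨z, by rw [← Finset.insert_erase ha, hz], fun h' => ?_⟩
  have : z ∈ (nb G S v).erase a := by simp [hz]
  exact (Finset.mem_erase.1 this).1 h'.symm

variable [Finite V]

/-- A leaf is matched with its neighbour `u`, and removing both lowers `k` by `d(u) - 1`. This is
positive, since otherwise the connected graph would be `K₂`. -/
theorem Bnd.of_leaf (hG : Good col G) (hI : IH col G S) (hS : Conn G S)
    (hK : ¬IsCopy tableK G S) {D : Prop} {v : V} (hv : v ∈ S) (h : (nb G S v).card ≤ 1) :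
    Bnd G S D := by
  refine Bnd.of_le ia_le_cOne ?_
  rcases Nat.le_one_iff_eq_zero_or_eq_one.1 h with h0 | h1
  · rw [numPM_eq_zero hv (Finset.card_eq_zero.1 h0)]
    have := mul_pos ia_pos (weight_pos G S)
    simpa using this.le
  · obtain ⟨u, hu⟩ := Finset.card_eq_one.1 h1
    obtain ⟨huS, hvu⟩ := mem_nb.1 (show u ∈ nb G S v by simp [hu])
    obtain ⟨h2, h3⟩ := leaf_excess hv hu
    have hvn : v ∈ nb G S u := mem_nb.2 ⟨hv, hvu.symm⟩
    rcases Nat.lt_or_ge (nb G S u).card 2 with h4 | h4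
    · exfalso
      obtain ⟨w, hw⟩ := Finset.card_eq_one.1 (le_antisymm (Nat.lt_succ_iff.1 h4)
        (Finset.card_pos.2 ⟨v, hvn⟩))
      have hwv : v = w := by simpa [hw] using hvn
      refine hK (copyK_of_adj hG hvu (hS.2 {v, u} ⟨?_, ?_⟩ ⟨v, by simp⟩).symm)
      · intro z hz
        simp only [Finset.mem_insert, Finset.mem_singleton] at hz
        rcases hz with rfl | rfl <;> assumption
      · intro a ha b hb hab
        simp only [Finset.mem_insert, Finset.mem_singleton] at ha
        rcases ha with rfl | rfl
        · have : b ∈ nb G S a := mem_nb.2 ⟨hb, hab⟩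
          rw [hu] at this
          simp only [Finset.mem_singleton] at this
          simp [this]
        · have : b ∈ nb G S a := mem_nb.2 ⟨hb, hab⟩
          rw [hw] at this
          simp only [Finset.mem_singleton] at this
          simp [this, hwv]
    · rw [h2]
      refine (hI.le hG (ssubset_of_erase hv (Finset.erase_subset _ _))).trans ?_
      simpa using weight_le (G := G) (S := S) (H := G) (T := (S.erase v).erase u) 1
        (by push_cast; omega)

/-- Four consecutive vertices of degree 2, followed by a fifth one. -/
theorem four_chain_end (hG : Good col G) (hI : IH col G S) (hS : Conn G S)
    (hmin : ∀ v ∈ S, 2 ≤ (nb G S v).card) {x a b c d y : V} (ha : nb G S a = {x, b})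
    (hb : nb G S b = {a, c}) (hc : nb G S c = {b, d}) (hd : nb G S d = {c, y}) (hxb : x ≠ b)
    (hac : a ≠ c) (hbd : b ≠ d) (hcy : c ≠ y) (hy : (nb G S y).card = 2) :
    IsCopy tableC G S ∨ (numPM G S : ℝ) ≤ ia * weight G S := by
  obtain ⟨hxS, hax⟩ := left_mem_of_nb ha
  obtain ⟨hbS, hab⟩ := right_mem_of_nb ha
  obtain ⟨haS, -⟩ := left_mem_of_nb hb
  obtain ⟨hcS, hbc⟩ := right_mem_of_nb hb
  obtain ⟨hdS, hcd⟩ := right_mem_of_nb hc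
  obtain ⟨hyS, hdy⟩ := right_mem_of_nb hd
  have c1 : col x = col b := hG.col_eq hax.symm hab
  have c2 : col a = col c := hG.col_eq hab hbc
  have c3 : col b = col d := hG.col_eq hbc hcd
  have c4 : col c = col y := hG.col_eq hcd hdy
  have hxd : x ≠ d := by
    rintro rfl
    exact hac (hG.c4 hax.symm hcd.symm hab.symm hbc hxb)
  have hya : y ≠ a := by
    rintro rfl
    exact hbd (hG.c4 hab hdy.symm hbc.symm hcd hac)
  have nyb : ¬G.Adj y b := fun h => by
    have : y ∈ nb G S b := mem_nb.2 ⟨hyS, h.symm⟩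
    rw [hb] at this
    simp only [Finset.mem_insert, Finset.mem_singleton] at this
    grind
  have hdy' : d ∈ nb G S y := mem_nb.2 ⟨hdS, hdy.symm⟩
  obtain ⟨z, hz⟩ := Finset.card_eq_one.1
    (show ((nb G S y).erase d).card = 1 by rw [Finset.card_erase_of_mem hdy', hy])
  have hzm : z ∈ (nb G S y).erase d := by simp [hz]
  obtain ⟨hzd, hzn⟩ := Finset.mem_erase.1 hzm
  obtain ⟨hzS, hyz⟩ := mem_nb.1 hzn
  have hyn : nb G S y = {d, z} := by rw [← Finset.insert_erase hdy', hz]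
  have c5 : col d = col z := hG.col_eq hdy hyz
  obtain ⟨e1, e2, e3⟩ := four_chain hG ha hb hc hd hxb hac hbd hcy
  -- In the first summand `y` has lost `d` and become a leaf; removing it with `z` raises the gain
  -- from 3 to 4.
  have hyT : nb G ((((S.erase b).erase a).erase c).erase d) y = {z} := by
    rw [nb_erase, nb_erase_of_not_adj (hG.not_adj c4.symm),
      nb_erase_of_not_adj (hG.not_adj (by rw [← c4, c2])), nb_erase_of_not_adj nyb, hz]
  have hyd : y ≠ d := hdy.ne'
  have hyb : y ≠ b := fun h => hG.ne hab (by rw [c2, c4, h])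
  obtain ⟨l1, l2⟩ := leaf_excess (G := G) (S := (((S.erase b).erase a).erase c).erase d) (v := y)
    (by simp [hyS, hya, hcy.symm, hyd, hyb]) hyT
  have hzT : nb G ((((S.erase b).erase a).erase c).erase d) z = ((nb G S z).erase a).erase c := by
    rw [nb_erase_of_not_adj (hG.not_adj c5.symm), nb_erase, nb_erase,
      nb_erase_of_not_adj (hG.not_adj (by rw [← c5, c3]))]
  have hzc : c ∉ nb G S z := fun h => by
    have : z ∈ nb G S c := mem_nb.2 ⟨hzS, (mem_nb.1 h).2.symm⟩
    rw [hc] at this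
    simp only [Finset.mem_insert, Finset.mem_singleton] at this
    grind
  -- Both summands then carry `ia ^ 4`, and `2 * ia ^ 4 = ia`.
  have main : 2 ≤ ((nb G S z).erase a).card → 4 ≤ (nb G S x).card + 2 - (if G.Adj x y then 1 else 0) →
      (numPM G S : ℝ) ≤ ia * weight G S := by
    intro h1 h2
    have := le_add_of_excess hI hG (S := S)
      (T₁ := ((((S.erase b).erase a).erase c).erase d |>.erase y).erase z)
      (T₂ := (((((S.erase b).erase c).erase a).erase x).erase d).erase y)
      (ssubset_of_erase hbS (by intro w; simp only [Finset.mem_erase]; tauto))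
      (ssubset_of_erase hbS (by intro w; simp only [Finset.mem_erase]; tauto)) (by rw [e1, l1]) 4 4
      (by
        rw [l2, e2, hzT, Finset.erase_eq_of_notMem (fun h => hzc (Finset.mem_of_mem_erase h))]
        push_cast; omega)
      (by rw [e3, hy]; split_ifs at h2 ⊢ <;> push_cast <;> omega)
    rw [ia_pow_four] at this
    linarith
  -- If `z = x`, the chain closes to a hexagon, which is everything unless `x` has a third
  -- neighbour.
  by_cases hzx : z = x
  · subst hzx
    have haz : a ∈ nb G S z := mem_nb.2 ⟨haS, hax.symm⟩
    rcases Nat.lt_or_ge (nb G S z).card 3 with h3 | h3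
    · left
      have h4 : (nb G S z).card = 2 := le_antisymm (Nat.lt_succ_iff.1 h3) (hmin z hzS)
      have hzn' : nb G S z = {a, y} := by
        symm
        refine Finset.eq_of_subset_of_card_le ?_ (by rw [h4, Finset.card_pair hya.symm])
        intro w hw
        simp only [Finset.mem_insert, Finset.mem_singleton] at hw
        rcases hw with rfl | rfl
        · exact haz
        · exact mem_nb.2 ⟨hyS, hyz.symm⟩
      exact hexagon_of_nb hG hS hzn' ha hb hc hd hyn hxb hbd hxd hac
        hcy hya.symm
    · right
      refine main ?_ ?_
      · rw [Finset.card_erase_of_mem haz]; omega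
      · split_ifs <;> omega
  · right
    have hza : a ∉ nb G S z := fun h => by
      have : z ∈ nb G S a := mem_nb.2 ⟨hzS, (mem_nb.1 h).2.symm⟩
      rw [ha] at this
      simp only [Finset.mem_insert, Finset.mem_singleton] at this
      rcases this with h | rfl
      · exact hzx h
      · exact nyb hyz
    have hxy : ¬G.Adj x y := fun h => by
      have : x ∈ nb G S y := mem_nb.2 ⟨hxS, h.symm⟩
      rw [hyn] at this
      simp only [Finset.mem_insert, Finset.mem_singleton] at this
      grind
    refine main ?_ ?_
    · rw [Finset.erase_eq_of_notMem hza]; exact hmin z hzS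
    · rw [if_neg hxy]; have := hmin x hxS; omega

/-- An end of degree 2 is handled by `four_chain_end`. Otherwise both outer degrees are at least 3,
and the gains are 3 and at least `3 + 3 - 1 = 5`, even if `x` and `y` are adjacent. -/
theorem four_chain_bound (hG : Good col G) (hI : IH col G S) (hS : Conn G S)
    (hmin : ∀ v ∈ S, 2 ≤ (nb G S v).card) {D : Prop} (hC : ¬IsCopy tableC G S) {x a b c d y : V}
    (ha : nb G S a = {x, b}) (hb : nb G S b = {a, c}) (hc : nb G S c = {b, d})
    (hd : nb G S d = {c, y}) (hxb : x ≠ b) (hac : a ≠ c) (hbd : b ≠ d) (hcy : c ≠ y) :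
    Bnd G S D := by
  obtain ⟨hxS, -⟩ := left_mem_of_nb ha
  obtain ⟨hyS, -⟩ := right_mem_of_nb hd
  rcases (hmin y hyS).eq_or_lt with hy | hy
  · exact Bnd.of_le ia_le_cOne
      ((four_chain_end hG hI hS hmin ha hb hc hd hxb hac hbd hcy hy.symm).resolve_left hC)
  rcases (hmin x hxS).eq_or_lt with hx | hx
  · rw [Finset.pair_comm] at ha hb hc hd
    exact Bnd.of_le ia_le_cOne ((four_chain_end hG hI hS hmin hd hc hb ha hcy.symm hbd.symm
      hac.symm hxb.symm hx.symm).resolve_left hC)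
  · obtain ⟨e1, e2, e3⟩ := four_chain hG ha hb hc hd hxb hac hbd hcy
    obtain ⟨hbS, -⟩ := left_mem_of_nb hc
    refine Bnd.of_le ?_ (le_add_of_excess hI hG
      (ssubset_of_erase hbS (by intro w; simp only [Finset.mem_erase]; tauto))
      (ssubset_of_erase hbS (by intro w; simp only [Finset.mem_erase]; tauto)) e1 3 5
      (by rw [e2]; norm_num) (by rw [e3]; split_ifs <;> push_cast <;> omega))
    rw [cOne_eq, ia_pow_three, ia_pow_five, ia_pow_seven]
    linarith [ia_gt, ia_sq_gt]

/-- An outer vertex of degree 2 extends the chain to four vertices; otherwise both gains are at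
least 4, and `2 * ia ^ 4 = ia`. -/
theorem three_chain_bound (hG : Good col G) (hI : IH col G S) (hS : Conn G S)
    (hmin : ∀ v ∈ S, 2 ≤ (nb G S v).card) {D : Prop} (hC : ¬IsCopy tableC G S) {x a b c y : V}
    (ha : nb G S a = {x, b}) (hb : nb G S b = {a, c}) (hc : nb G S c = {b, y})
    (hxb : x ≠ b) (hac : a ≠ c) (hby : b ≠ y) : Bnd G S D := by
  obtain ⟨hxS, hax⟩ := left_mem_of_nb ha
  obtain ⟨hyS, hcy⟩ := right_mem_of_nb hc
  obtain ⟨haS, -⟩ := left_mem_of_nb hb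
  obtain ⟨hcS, -⟩ := right_mem_of_nb hb
  rcases (hmin y hyS).eq_or_lt with hy | hy
  · obtain ⟨z, hz, hz'⟩ := eq_pair_of_card hy.symm (mem_nb.2 ⟨hcS, hcy.symm⟩)
    exact four_chain_bound hG hI hS hmin hC ha hb hc hz hxb hac hby hz'
  rcases (hmin x hxS).eq_or_lt with hx | hx
  · obtain ⟨z, hz, hz'⟩ := eq_pair_of_card hx.symm (mem_nb.2 ⟨haS, hax.symm⟩)
    rw [Finset.pair_comm] at hz
    exact four_chain_bound hG hI hS hmin hC hz ha hb hc hz'.symm hxb hac hby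
  · refine Bnd.of_le ?_ (three_chain hG hI ha hb hc hxb hac hby 3 3 hx hy)
    rw [cOne_eq, ia_pow_four, ia_pow_seven]
    linarith [ia_lt, ia_sq_gt]

end

/-! ### A vertex of degree 2 with both neighbours of higher degree -/

section

variable {V : Type*} {col : V → Bool} {G : SimpleGraph V} {S : Finset V}

theorem card_nb_mono {T : Finset V} (h : T ⊆ S) (v : V) : (nb G T v).card ≤ (nb G S v).card :=
  Finset.card_le_card (Finset.filter_subset_filter _ h)

theorem excess_erase_pair_of_deg_two {v p : V} {q : V} (hv : nb G S v = {p, q}) (hvS : v ∈ S)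
    (hpq : p ≠ q) : excess G ((S.erase v).erase p) = excess G S - 2 * (nb G S p).card := by
  rw [excess_pair hvS (mem_nb.2 (left_mem_of_nb hv)), hv, Finset.card_pair hpq]
  push_cast; ring

variable [Finite V]

/-- A component with a vertex of degree at most 2 that is not exceptional gives the bounds. -/
theorem Bnd.of_component (hG : Good col G) (hI : IH col G S) {T A : Finset V} (hT : T ⊂ S)
    (hA : IsClosedIn G T A) (hA' : Conn G A) (hlow : ∃ v ∈ A, (nb G A v).card ≤ 2)
    (hE : ¬Exc G A) : Bnd G T (∀ v ∈ S, (nb G S v).card ≤ 3) := by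
  have hAS : A ⊂ S := lt_of_le_of_lt hA.1 hT
  have h1 := hI G A hG (size_lt hAS)
  have h2 := hI.le hG (lt_of_le_of_lt (Finset.sdiff_subset (s := T) (t := A)) hT)
  exact ⟨le_of_component hA (h1.c hA' hlow hE) h2, fun hD =>
    le_of_component hA (h1.b hA' hlow (fun v hv => (card_nb_mono hAS.subset v).trans
      (hD v (hAS.subset hv))) hE) h2⟩

/-- Without `v` and `p`, the vertex `q` has degree 2, so induction improves the bound unless the
component `C` of `q` is exceptional. In that case `p` has at most one neighbour in `C`. If it has
one, the third edge at `p` is a cut edge; if it has none, `qv` is. -/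
theorem single_aux (hG : Good col G) (hI : IH col G S) {v p q : V} (hv : nb G S v = {p, q})
    (hvS : v ∈ S) (hpq : p ≠ q) (hp : (nb G S p).card = 3) (hq : (nb G S q).card = 3) :
    (numPM G S : ℝ) ≤ ia * weight G S ∨
      Bnd G ((S.erase v).erase p) (∀ v ∈ S, (nb G S v).card ≤ 3) := by
  obtain ⟨hpS, hvp⟩ := left_mem_of_nb hv
  obtain ⟨hqS, hvq⟩ := right_mem_of_nb hv
  have hcpq : col p = col q := hG.col_eq hvp.symm hvq
  have hvn : v ∈ nb G S p := mem_nb.2 ⟨hvS, hvp.symm⟩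
  have hvn' : v ∈ nb G S q := mem_nb.2 ⟨hvS, hvq.symm⟩
  have hqT : q ∈ (S.erase v).erase p := by simp [hpq.symm, hvq.ne', hqS]
  have hcardq : (nb G ((S.erase v).erase p) q).card = 2 := by
    rw [nb_erase_of_not_adj (hG.not_adj hcpq.symm), nb_erase, Finset.card_erase_of_mem hvn', hq]
  obtain ⟨C, hqC, hC, hC'⟩ := exists_component G hqT
  have hCS : C ⊆ S := hC.1.trans ((Finset.erase_subset _ _).trans (Finset.erase_subset _ _))
  have hpC : p ∉ C := fun h => by simpa using hC.1 h
  have hvC : v ∉ C := fun h => by simpa using hC.1 h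
  by_cases hE : Exc G C
  swap
  · right
    exact Bnd.of_component hG hI (ssubset_of_erase hvS (Finset.erase_subset _ _)) hC hC'
      ⟨q, hqC, by rw [hC.nb_eq hqC, hcardq]⟩ hE
  left
  have hout : ∀ a ∈ C, ∀ b ∈ S, b ∉ C → G.Adj a b → b = v ∨ b = p := by
    intro a ha b hb hbC hab
    by_contra hcon
    push Not at hcon
    exact hbC (hC.2 a ha b (by simp [hcon, hb]) hab)
  have hvnb : ∀ a ∈ S, G.Adj v a → a = p ∨ a = q := by
    intro a ha hva
    have : a ∈ nb G S v := mem_nb.2 ⟨ha, hva⟩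
    simpa [hv] using this
  by_cases hex : ∃ r ∈ C, G.Adj p r
  · obtain ⟨r, hrC, hpr⟩ := hex
    have hrv : r ≠ v := fun h => hvC (h ▸ hrC)
    have hrn : r ∈ (nb G S p).erase v := Finset.mem_erase.2 ⟨hrv, mem_nb.2 ⟨hCS hrC, hpr⟩⟩
    obtain ⟨s, hs⟩ := Finset.card_eq_one.1 (show (((nb G S p).erase v).erase r).card = 1 by
      rw [Finset.card_erase_of_mem hrn, Finset.card_erase_of_mem hvn, hp])
    have hsm : s ∈ ((nb G S p).erase v).erase r := by simp [hs]
    simp only [Finset.mem_erase] at hsm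
    obtain ⟨hsr, hsv, hsn⟩ := hsm
    obtain ⟨hsS, hps⟩ := mem_nb.1 hsn
    have hsC : s ∉ C := fun h => hsr (hE.eq_of_adj hG hpC h hrC hps hpr)
    refine bridge hG hI (A := insert p (insert v C)) ?_ (u := p) (v := s) (by simp) hsS ?_ hps
      (by omega) ?_
    · intro w hw
      simp only [Finset.mem_insert] at hw
      rcases hw with rfl | rfl | hw
      exacts [hpS, hvS, hCS hw]
    · simp [hps.ne', hsv, hsC]
    · intro a ha b hb hbA hab
      simp only [Finset.mem_insert, not_or] at ha hbA
      rcases ha with rfl | rfl | ha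
      · refine ⟨rfl, ?_⟩
        by_contra hbs
        have : b ∈ ((nb G S a).erase v).erase r := by
          simp only [Finset.mem_erase]
          exact ⟨fun h => hbA.2.2 (h ▸ hrC), hbA.2.1, mem_nb.2 ⟨hb, hab⟩⟩
        rw [hs] at this
        exact hbs (by simpa using this)
      · rcases hvnb b hb hab with h | h
        · exact absurd h hbA.1
        · exact absurd (h ▸ hqC) hbA.2.2
      · rcases hout a ha b hb hbA.2.2 hab with h | h
        · exact absurd h hbA.2.1
        · exact absurd h hbA.1
  · push Not at hex
    refine bridge hG hI hCS hqC hvS hvC hvq.symm (by omega) ?_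
    intro a ha b hb hbC hab
    rcases hout a ha b hb hbC hab with rfl | rfl
    · refine ⟨?_, rfl⟩
      rcases hvnb a (hCS ha) hab.symm with rfl | h
      · exact absurd ha hpC
      · exact h
    · exact absurd hab.symm (hex a ha)

theorem single_bound (hG : Good col G) (hI : IH col G S) {v p q : V} (hv : nb G S v = {p, q})
    (hvS : v ∈ S) (hpq : p ≠ q) (hp : 3 ≤ (nb G S p).card) (hq : 3 ≤ (nb G S q).card) :
    Bnd G S (∀ v ∈ S, (nb G S v).card ≤ 3) := by
  obtain ⟨hpS, hvp⟩ := left_mem_of_nb hv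
  obtain ⟨hqS, hvq⟩ := right_mem_of_nb hv
  have hv' := hv
  rw [Finset.pair_comm] at hv'
  have e1 := excess_erase_pair_of_deg_two hv hvS hpq
  have e2 := excess_erase_pair_of_deg_two hv' hvS hpq.symm
  have hsum := numPM_pair hvS hv hpq
  have hs : ∀ w, (S.erase v).erase w ⊂ S := fun w => ssubset_of_erase hvS (Finset.erase_subset _ _)
  have hW := weight_pos G S
  rcases hp.eq_or_lt with hp3 | hp4
  · rcases hq.eq_or_lt with hq3 | hq4
    · rcases single_aux hG hI hv hvS hpq hp3.symm hq3.symm with h | h1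
      · exact Bnd.of_le ia_le_cOne h
      rcases single_aux hG hI hv' hvS hpq.symm hq3.symm hp3.symm with h | h2
      · exact Bnd.of_le ia_le_cOne h
      -- Each summand has exactly half the weight of `S`, so a constant valid for both is inherited
      -- by the sum.
      have w1 := weight_eq (G := G) (S := S) (H := G) (T := (S.erase v).erase p) 3
        (by rw [e1]; push_cast; omega)
      have w2 := weight_eq (G := G) (S := S) (H := G) (T := (S.erase v).erase q) 3
        (by rw [e2]; push_cast; omega)
      rw [ia_pow_three] at w1 w2
      unfold Bnd at h1 h2 ⊢
      rw [w1] at h1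
      rw [w2] at h2
      rw [hsum]
      push_cast
      exact ⟨by linarith [h1.1, h2.1], fun hD => by linarith [h1.2 hD, h2.2 hD]⟩
    -- Degrees 3 and 4 give exactly `ia ^ 3 + ia ^ 4 = cTwo`; the bound for maximum degree 3 is
    -- vacuous.
    · refine ⟨?_, fun hD => absurd (hD q hqS) (by omega)⟩
      rw [cTwo_eq]
      exact le_add_of_excess hI hG (hs p) (hs q) hsum 3 4 (by rw [e1]; push_cast; omega)
        (by rw [e2]; push_cast; omega)
  · refine ⟨?_, fun hD => absurd (hD p hpS) (by omega)⟩
    rw [cTwo_eq]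
    exact le_add_of_excess hI hG (hs q) (hs p) (by rw [hsum, add_comm]) 3 4
      (by rw [e2]; push_cast; omega) (by rw [e1]; push_cast; omega)

end

/-! ### Proper parts of graphs of maximum degree 3, and small counts -/

section

variable {V : Type*} {col : V → Bool} {G : SimpleGraph V} {S : Finset V}

theorem alpha_lt : alpha < 1.26 := by
  by_contra! h
  have := pow_le_pow_left₀ (by norm_num) h 3
  rw [alpha_pow_three] at this
  norm_num at this

theorem ia_mul_alpha : ia * alpha = 1 := inv_mul_cancel₀ alpha_pos.ne'

theorem weight_le_pow (k : ℕ) (h : excess G S ≤ 2 * k) : weight G S ≤ alpha ^ k := by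
  rw [weight, ← Real.rpow_natCast]
  apply Real.rpow_le_rpow_of_exponent_le one_lt_alpha.le
  have : (excess G S : ℝ) ≤ 2 * k := by exact_mod_cast h
  linarith

theorem weight_eq_pow (k : ℕ) (h : excess G S = 2 * k) : weight G S = alpha ^ k := by
  rw [weight_of_excess h, zpow_natCast]

theorem numPM_le_one (h : (numPM G S : ℝ) ≤ weight G S) (h' : excess G S ≤ 4) :
    numPM G S ≤ 1 := by
  have h1 := h.trans (weight_le_pow 2 (by push_cast; omega))
  have h2 : alpha ^ 2 < 2 := by nlinarith [alpha_lt, alpha_pos]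
  have h3 : (numPM G S : ℝ) < 2 := by linarith
  have : numPM G S < 2 := by exact_mod_cast h3
  omega

/-- The weight is `α ^ 5 < 4`, so the integer count is at most `3 = α ^ 3 + 1 = (ia ^ 2 + ia ^ 5) *
α ^ 5`. -/
theorem numPM_le_of_tableJ (hJ : IsCopy tableJ G S) (h : (numPM G S : ℝ) ≤ weight G S) :
    (numPM G S : ℝ) ≤ (ia ^ 2 + ia ^ 5) * weight G S := by
  have hw := weight_eq_pow (G := G) (S := S) 5 (by rw [excess_tableJ hJ]; norm_num)
  have h1 : alpha ^ 5 < 4 := by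
    rw [show alpha ^ 5 = alpha ^ 3 * alpha ^ 2 by ring, alpha_pow_three]
    nlinarith [alpha_lt, alpha_pos]
  rw [hw] at h ⊢
  have h2 : numPM G S < 4 := by
    have : (numPM G S : ℝ) < 4 := by linarith
    exact_mod_cast this
  have h3 : (ia ^ 2 + ia ^ 5) * alpha ^ 5 = 3 := by
    rw [show (ia ^ 2 + ia ^ 5) * alpha ^ 5 =
      (ia * alpha) ^ 2 * alpha ^ 3 + (ia * alpha) ^ 5 by ring, ia_mul_alpha, alpha_pow_three]
    norm_num
  rw [h3]
  exact_mod_cast Nat.lt_succ_iff.1 h2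

theorem IsCopy.card {m : ℕ} {N : Fin m → Finset (Fin m)} (h : IsCopy N G S) : S.card = m := by
  obtain ⟨f, hf, rfl, -⟩ := h
  rw [Finset.card_image_of_injective _ hf, Finset.card_univ, Fintype.card_fin]

/-- A proper part of a connected graph of maximum degree 3 is better than `graphJ`, unless it is
`K₂` or a hexagon. -/
theorem le_of_proper_component (hG : Good col G) (hI : IH col G S) (hS : Conn G S)
    (hD : ∀ v ∈ S, (nb G S v).card ≤ 3) {A : Finset V} (hAS : A ⊂ S) (hA : Conn G A)
    (hK : ¬IsCopy tableK G A) (hC : ¬IsCopy tableC G A) :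
    (numPM G A : ℝ) ≤ (ia ^ 2 + ia ^ 5) * weight G A := by
  by_cases hJ : IsCopy tableJ G A
  · exact numPM_le_of_tableJ hJ (hI.le hG hAS)
  -- By connectedness an edge leaves `A`; its end in `A` keeps at most two neighbours there.
  have hex : ∃ v ∈ A, (nb G A v).card ≤ 2 := by
    by_contra! hcon
    refine hAS.ne (hS.2 A ⟨hAS.subset, fun a ha b hb hab => ?_⟩ hA.1)
    by_contra hbA
    have h1 : b ∈ nb G S a := mem_nb.2 ⟨hb, hab⟩
    have h2 : nb G A a ⊆ (nb G S a).erase b := fun w hw => by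
      rw [mem_nb] at hw
      exact Finset.mem_erase.2 ⟨fun h => hbA (h ▸ hw.1), mem_nb.2 ⟨hAS.subset hw.1, hw.2⟩⟩
    have h3 := Finset.card_le_card h2
    rw [Finset.card_erase_of_mem h1] at h3
    have h4 := hD a (hAS.subset ha)
    have h5 := hcon a ha
    omega
  refine ((hI G A hG (size_lt hAS)).b hA hex (fun v hv => (card_nb_mono hAS.subset v).trans
    (hD v (hAS.subset hv))) (by unfold Exc; tauto)).trans
    (mul_le_mul_of_nonneg_right ?_ (weight_pos G A).le)
  rw [cOne_eq, ia_pow_seven, ia_pow_five]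
  linarith [ia_lt, ia_sq_gt]

theorem numPM_erase_pair_le_one (hG : Good col G) (hI : IH col G S) {A : Finset V}
    (hA : IsCopy tableK G A ∨ IsCopy tableC G A) (hAS : A ⊂ S) {p q : V} (hp : p ∈ A)
    (hq : q ∈ A) (hpq : p ≠ q) : numPM G ((A.erase p).erase q) ≤ 1 := by
  refine numPM_le_one (hI.le hG (lt_of_le_of_lt ((Finset.erase_subset _ _).trans
    (Finset.erase_subset _ _)) hAS)) ?_
  rw [excess_erase G (Finset.mem_erase.2 ⟨hpq.symm, hq⟩), excess_erase G hp, nb_erase]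
  have h1 := Finset.pred_card_le_card_erase (s := nb G A q) (a := p)
  rcases hA with hA | hA
  · rw [excess_tableK hA, card_nb_tableK hA hp]
    rw [card_nb_tableK hA hq] at h1
    push_cast; omega
  · rw [excess_tableC hA, card_nb_tableC hA hp]
    rw [card_nb_tableC hA hq] at h1
    push_cast; omega

/-- Nonadjacent vertices of opposite colours are antipodal in a hexagon, so `x a b y` is the
additional path of `J`. -/
theorem isCopy_tableJ_of_hexagon (hG : Good col G) {x a b y : V}
    (hT : IsCopy tableC G ((S.erase a).erase b)) (hx : x ∈ (S.erase a).erase b)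
    (hy : y ∈ (S.erase a).erase b) (hxy : ¬G.Adj x y) (hc : col x ≠ col y) (haS : a ∈ S)
    (hbS : b ∈ S) (hxa : G.Adj x a) (hab : G.Adj a b) (hby : G.Adj b y) : IsCopy tableJ G S := by
  obtain ⟨f, hf, hfS, h⟩ := hT
  have hmem : ∀ i, f i ∈ (S.erase a).erase b := fun i => by rw [← hfS]; simp
  have hna : ∀ i, f i ≠ a := fun i h' => by simpa [h'] using hmem i
  have hnb : ∀ i, f i ≠ b := fun i h' => by simpa [h'] using hmem i
  rw [← hfS] at hx hy
  simp only [Finset.mem_image, Finset.mem_univ, true_and] at hx hy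
  obtain ⟨i, rfl⟩ := hx
  obtain ⟨j, rfl⟩ := hy
  have hj : j = i + 3 := by
    have h1 : ∀ i j : Fin 6, j ∉ tableC i → (∀ c, c ∈ tableC i → c ∉ tableC j) → j = i + 3 := by
      decide
    refine h1 i j (fun h' => hxy ((h i j).2 h')) fun c hi hj => hc ?_
    exact hG.col_eq ((h i c).2 hi) ((h j c).2 hj).symm
  subst hj
  refine copyJ_of_adj hG (x := f i) (a := f (i + 1)) (b := f (i + 2)) (y := f (i + 3))
    (c := f (i + 4)) (d := f (i + 5)) (e := a) (f := b)
    ((h _ _).2 ?_) ((h _ _).2 ?_) ((h _ _).2 ?_) ((h _ _).2 ?_) ((h _ _).2 ?_) ((h _ _).2 ?_)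
    hxa hab hby (hf.ne ?_) (hf.ne ?_) (hnb _) (hf.ne ?_) (hnb _) (hnb _) (hf.ne ?_) (hf.ne ?_)
    (hna _) (hf.ne ?_) (hna _) (hna _) ?_
  iterate 12
    · clear hxy hc hxa hby; revert i; decide
  intro z
  constructor
  · intro hz
    by_cases hza : z = a
    · simp [hza]
    by_cases hzb : z = b
    · simp [hzb]
    have hz' : z ∈ Finset.univ.image f := by rw [hfS]; simp [hza, hzb, hz]
    obtain ⟨k, -, rfl⟩ := Finset.mem_image.1 hz'
    have h1 : ∀ i k : Fin 6, k = i ∨ k = i + 1 ∨ k = i + 2 ∨ k = i + 3 ∨ k = i + 4 ∨ k = i + 5 := by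
      decide
    rcases h1 i k with h | h | h | h | h | h <;> simp [h]
  · have h1 : ∀ i, f i ∈ S := fun i => Finset.mem_of_mem_erase (Finset.mem_of_mem_erase (hmem i))
    rintro (rfl | rfl | rfl | rfl | rfl | rfl | rfl | rfl)
    exacts [h1 _, h1 _, h1 _, h1 _, h1 _, h1 _, haS, hbS]

variable [Finite V]

/-- Counting perfect matchings of `y` together with two even parts, one of which has lost a
vertex. -/
theorem numPM_le_of_two_parts {U A B : Finset V} {p q r y : V}
    (hU : ∀ z, z ∈ U ↔ z = y ∨ (z ∈ A ∧ z ≠ p) ∨ z ∈ B) (hAB : ∀ z ∈ A, z ∉ B) (hyA : y ∉ A)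
    (hyB : y ∉ B) (hno : ∀ a ∈ A, ∀ b ∈ B, ¬G.Adj a b) (hnb : nb G U y = {q, r}) (hp : p ∈ A)
    (hq : q ∈ A) (hr : r ∈ B) (hA : Even A.card)
    (h1 : numPM G ((A.erase p).erase q) ≤ 1) : numPM G U ≤ numPM G B := by
  have hyU : y ∈ U := (hU y).2 (Or.inl rfl)
  have hqr : q ≠ r := fun h => hAB q hq (h ▸ hr)
  -- If `y` is matched with `r`, the odd set `A.erase p` remains cut off and contributes nothing. If
  -- `y` is matched with `q`, `B` splits off and the rest of `A` has at most one matching.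
  rw [numPM_pair hyU hnb hqr]
  have hqB := hAB q hq
  have hpB := hAB p hp
  have hyq : y ≠ q := fun h => hyA (h ▸ hq)
  have c1 : IsClosedIn G ((U.erase y).erase q) B := by
    refine ⟨fun z hz => ?_, fun a ha b hb hab => ?_⟩
    · simp only [Finset.mem_erase, hU]
      exact ⟨fun h => hqB (h ▸ hz), fun h => hyB (h ▸ hz), Or.inr (Or.inr hz)⟩
    · simp only [Finset.mem_erase, hU] at hb
      rcases hb.2.2 with h | h | h
      · exact absurd h hb.2.1
      · exact absurd hab.symm (hno b h.1 a ha)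
      · exact h
  have c2 : IsClosedIn G ((U.erase y).erase r) (A.erase p) := by
    refine ⟨fun z hz => ?_, fun a ha b hb hab => ?_⟩
    · simp only [Finset.mem_erase, hU] at hz ⊢
      exact ⟨fun h => hAB z hz.2 (h ▸ hr), fun h => hyA (h ▸ hz.2), Or.inr (Or.inl ⟨hz.2, hz.1⟩)⟩
    · simp only [Finset.mem_erase, hU] at hb ha ⊢
      rcases hb.2.2 with h | h | h
      · exact absurd h hb.2.1
      · exact ⟨h.2, h.1⟩
      · exact absurd hab (hno a ha.2 b h)
  have e1 : ((U.erase y).erase q) \ B = (A.erase p).erase q := by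
    ext z
    simp only [Finset.mem_sdiff, Finset.mem_erase, hU]
    constructor
    · tauto
    · rintro ⟨h1, h2, h3⟩
      exact ⟨⟨h1, fun h => hyA (h ▸ h3), Or.inr (Or.inl ⟨h3, h2⟩)⟩, hAB z h3⟩
  have z2 : numPM G (A.erase p) = 0 := by
    by_contra h
    have h2 := even_card_of_numPM_ne_zero _ _ h
    have h3 := Finset.card_erase_add_one hp
    rw [← h3] at hA
    obtain ⟨m, hm⟩ := hA
    obtain ⟨l, hl⟩ := h2
    omega
  rw [numPM_mul G c1, numPM_mul G c2, z2, e1, zero_mul, add_zero]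
  exact (Nat.mul_le_mul_left _ h1).trans (mul_one _).le

end

/-! ### Two small components attached to a chain of two vertices -/

section

variable {V : Type*} {col : V → Bool} {G : SimpleGraph V} {S : Finset V}

theorem adj_of_tableK {A : Finset V} (h : IsCopy tableK G A) {p q : V} (hp : p ∈ A) (hq : q ∈ A)
    (hpq : p ≠ q) : G.Adj p q ∧ ∀ z ∈ A, z = p ∨ z = q := by
  obtain ⟨f, hf, rfl, h⟩ := h
  simp only [Finset.mem_image, Finset.mem_univ, true_and] at hp hq ⊢
  obtain ⟨i, rfl⟩ := hp
  obtain ⟨j, rfl⟩ := hq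
  have hij : i ≠ j := fun h => hpq (by rw [h])
  have h1 : ∀ i j : Fin 2, i ≠ j → j ∈ tableK i ∧ ∀ k, k = i ∨ k = j := by decide
  refine ⟨(h i j).2 (h1 i j hij).1, ?_⟩
  rintro _ ⟨k, rfl⟩
  exact ((h1 i j hij).2 k).imp (fun h => by rw [h]) (fun h => by rw [h])

theorem IsCopy.even_card {A : Finset V} (h : IsCopy tableK G A ∨ IsCopy tableC G A) :
    Even A.card := by
  rcases h with h | h <;> rw [h.card] <;> decide

variable [Finite V]

-- Write `m` and `m'` for the counts of `A` and `B`. Matchings avoiding `ab` number `m * m'`. Those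
-- containing `ab` match `x` with `p` or `p'`, and by `numPM_le_of_two_parts` these are at most `m'`
-- and `m`. Two copies of `K₂` would give `J`. In the other cases `m * m' + m + m'` is at most 5 or
-- 8, against `c₁ * α ^ 8 = 4 + α` and `c₁ * α ^ 11 = 8 + 2 * α`.
set_option maxHeartbeats 400000 in
theorem two_parts_bound (hG : Good col G) (hI : IH col G S) (hJ : ¬IsCopy tableJ G S)
    {x a b y : V} (ha : nb G S a = {x, b}) (hb : nb G S b = {a, y}) (hxb : x ≠ b) (hay : a ≠ y)
    (hx : (nb G S x).card = 3) (hy : (nb G S y).card = 3) {A B : Finset V}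
    (hA : IsClosedIn G ((((S.erase a).erase x).erase b).erase y) A)
    (hB : IsClosedIn G ((((S.erase a).erase x).erase b).erase y) B) (hAB : ∀ z ∈ A, z ∉ B)
    (hcov : ∀ z ∈ (((S.erase a).erase x).erase b).erase y, z ∈ A ∨ z ∈ B)
    (hA' : IsCopy tableK G A ∨ IsCopy tableC G A) (hB' : IsCopy tableK G B ∨ IsCopy tableC G B)
    {p p' q q' : V} (hp : p ∈ A) (hp' : p' ∈ B) (hq : q ∈ A) (hq' : q' ∈ B)
    (hxT : nb G ((S.erase a).erase b) x = {p, p'})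
    (hyT : nb G ((S.erase a).erase b) y = {q, q'}) :
    (numPM G S : ℝ) ≤ cOne * weight G S := by
  obtain ⟨hxS, hax⟩ := left_mem_of_nb ha
  obtain ⟨hbS, hab⟩ := right_mem_of_nb ha
  obtain ⟨haS, -⟩ := left_mem_of_nb hb
  obtain ⟨hyS, hby⟩ := right_mem_of_nb hb
  obtain ⟨-, hxp⟩ := left_mem_of_nb hxT
  obtain ⟨-, hxp'⟩ := right_mem_of_nb hxT
  obtain ⟨-, hyq⟩ := left_mem_of_nb hyT
  obtain ⟨-, hyq'⟩ := right_mem_of_nb hyT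
  have k1 : col p = col a := hG.col_eq hxp.symm hax.symm
  have k2 : col a = col y := hG.col_eq hab hby
  have k3 : col p' = col a := hG.col_eq hxp'.symm hax.symm
  have k4 : col q = col b := hG.col_eq hyq.symm hby.symm
  have k5 : col q' = col b := hG.col_eq hyq'.symm hby.symm
  have k6 := hG.ne hab
  have k7 : col x = col b := hG.col_eq hax.symm hab
  have hpq : p ≠ q := fun h => k6 (by rw [← k1, ← k4, h])
  have hpq' : p' ≠ q' := fun h => k6 (by rw [← k3, ← k5, h])
  have hxy : x ≠ y := fun h => k6 (by rw [k2, ← k7, h])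
  obtain ⟨e1, e2, e3⟩ := two_chain hG ha hb hxb hay
  set R := (((S.erase a).erase x).erase b).erase y with hR
  have hmA : ∀ z ∈ A, z ≠ y ∧ z ≠ b ∧ z ≠ x ∧ z ≠ a ∧ z ∈ S := fun z hz => by
    simpa [hR] using hA.1 hz
  have hmB : ∀ z ∈ B, z ≠ y ∧ z ≠ b ∧ z ≠ x ∧ z ≠ a ∧ z ∈ S := fun z hz => by
    simpa [hR] using hB.1 hz
  have hsR : R ⊂ S := ssubset_of_erase haS ((Finset.erase_subset _ _).trans
    ((Finset.erase_subset _ _).trans (Finset.erase_subset _ _)))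
  have hsA : A ⊂ S := lt_of_le_of_lt hA.1 hsR
  have hsB : B ⊂ S := lt_of_le_of_lt hB.1 hsR
  have hcov' : ∀ z ∈ S, z ≠ a → z ≠ b → z ≠ x → z ≠ y → z ∈ A ∨ z ∈ B := fun z h1 h2 h3 h4 h5 =>
    hcov z (by simp [hR, h1, h2, h3, h4, h5])
  have hpp' : p ≠ p' := fun h => hAB p hp (h ▸ hp')
  have hno : ∀ u ∈ A, ∀ w ∈ B, ¬G.Adj u w := fun u hu w hw h =>
    hAB w (hA.2 u hu w (hB.1 hw) h) hw
  have hyA : y ∉ A := fun h => (hmA y h).1 rfl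
  have hyB : y ∉ B := fun h => (hmB y h).1 rfl
  have hyx : ¬G.Adj y x := fun h => by
    have : x ∈ nb G ((S.erase a).erase b) y := mem_nb.2 ⟨by simp [hax.ne', hxb, hxS], h⟩
    rw [hyT] at this
    simp only [Finset.mem_insert, Finset.mem_singleton] at this
    rcases this with rfl | rfl
    · exact (hmA _ hq).2.2.1 rfl
    · exact (hmB _ hq').2.2.1 rfl
  have hxT' : x ∈ (S.erase a).erase b := by simp [hax.ne', hxb, hxS]
  have hU : ∀ r, nb G ((((S.erase a).erase b).erase x).erase r) y =
      (nb G ((S.erase a).erase b) y).erase r := fun r => by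
    rw [nb_erase, nb_erase_of_not_adj hyx]
  have t1 : numPM G ((((S.erase a).erase b).erase x).erase p) ≤ numPM G B := by
    refine numPM_le_of_two_parts (A := A) (B := B) (p := p) (q := q) (r := q') (y := y) ?_ hAB
      hyA hyB hno ?_ hp hq hq' (IsCopy.even_card hA')
      (numPM_erase_pair_le_one hG hI hA' hsA hp hq hpq)
    · intro z
      simp only [Finset.mem_erase]
      constructor
      · rintro ⟨h1, h2, h3, h4, h5⟩
        by_cases hzy : z = y
        · exact Or.inl hzy
        · rcases hcov' z h5 h4 h3 h2 hzy with h | h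
          · exact Or.inr (Or.inl ⟨h, h1⟩)
          · exact Or.inr (Or.inr h)
      · rintro (rfl | ⟨h, h'⟩ | h)
        · exact ⟨fun h => hyA (h ▸ hp), hxy.symm, hby.ne', hay.symm, hyS⟩
        · obtain ⟨m1, m2, m3, m4, m5⟩ := hmA z h
          exact ⟨h', m3, m2, m4, m5⟩
        · obtain ⟨m1, m2, m3, m4, m5⟩ := hmB z h
          exact ⟨fun h' => hAB p hp (h' ▸ h), m3, m2, m4, m5⟩
    · rw [hU, hyT, Finset.erase_eq_of_notMem]
      simp only [Finset.mem_insert, Finset.mem_singleton, not_or]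
      exact ⟨hpq, fun h => hAB p hp (h ▸ hq')⟩
  have t2 : numPM G ((((S.erase a).erase b).erase x).erase p') ≤ numPM G A := by
    refine numPM_le_of_two_parts (A := B) (B := A) (p := p') (q := q') (r := q) (y := y) ?_
      (fun z h1 h2 => hAB z h2 h1) hyB hyA (fun u hu w hw h => hno w hw u hu h.symm) ?_ hp' hq' hq
      (IsCopy.even_card hB') (numPM_erase_pair_le_one hG hI hB' hsB hp' hq' hpq')
    · intro z
      simp only [Finset.mem_erase]
      constructor
      · rintro ⟨h1, h2, h3, h4, h5⟩
        by_cases hzy : z = y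
        · exact Or.inl hzy
        · rcases hcov' z h5 h4 h3 h2 hzy with h | h
          · exact Or.inr (Or.inr h)
          · exact Or.inr (Or.inl ⟨h, h1⟩)
      · rintro (rfl | ⟨h, h'⟩ | h)
        · exact ⟨fun h => hyB (h ▸ hp'), hxy.symm, hby.ne', hay.symm, hyS⟩
        · obtain ⟨m1, m2, m3, m4, m5⟩ := hmB z h
          exact ⟨h', m3, m2, m4, m5⟩
        · obtain ⟨m1, m2, m3, m4, m5⟩ := hmA z h
          exact ⟨fun h' => hAB z h (h' ▸ hp'), m3, m2, m4, m5⟩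
    · rw [hU, hyT, Finset.erase_eq_of_notMem, Finset.pair_comm]
      simp only [Finset.mem_insert, Finset.mem_singleton, not_or]
      exact ⟨fun h => hAB q hq (h ▸ hp'), hpq'⟩
  have hRB : R \ A = B := by
    ext z
    simp only [Finset.mem_sdiff]
    exact ⟨fun h => (hcov z h.1).resolve_left h.2, fun h => ⟨hB.1 h, fun h' => hAB z h' h⟩⟩
  have hRm := numPM_mul G hA
  have hRe := hA.excess_add
  rw [hRB] at hRm hRe
  have hTm := numPM_pair hxT' hxT hpp'
  have hmain : numPM G S ≤ numPM G A * numPM G B + numPM G A + numPM G B := by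
    rw [e1, hTm, hRm]; omega
  rw [hRe, hx, hy] at e3
  have hK : ∀ E : Finset V, E ⊂ S → IsCopy tableK G E → numPM G E ≤ 1 := fun E hE h =>
    numPM_le_one (hI.le hG hE) (by rw [excess_tableK h]; norm_num)
  have hC : ∀ E : Finset V, E ⊂ S → IsCopy tableC G E → numPM G E ≤ 2 := fun E hE h => by
    have := hI.le hG hE
    rw [weight_eq_pow 3 (by rw [excess_tableC h]; norm_num), alpha_pow_three] at this
    exact_mod_cast this
  have five : (numPM G S : ℝ) ≤ 5 → excess G S = 16 → (numPM G S : ℝ) ≤ cOne * weight G S := by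
    intro h1 h2
    rw [weight_eq_pow (G := G) (S := S) 8 (by rw [h2]; norm_num), cOne_eq,
      show (ia ^ 2 + ia ^ 7) * alpha ^ 8 = (ia * alpha) ^ 2 * (alpha ^ 3) ^ 2 +
        (ia * alpha) ^ 7 * alpha by ring, ia_mul_alpha, alpha_pow_three]
    linarith [one_lt_alpha]
  rcases hA' with hA' | hA' <;> rcases hB' with hB' | hB'
  · exfalso
    obtain ⟨h1, h2⟩ := adj_of_tableK hA' hp hq hpq
    obtain ⟨h3, h4⟩ := adj_of_tableK hB' hp' hq' hpq'
    refine hJ (copyJ_of_adj hG (x := x) (a := a) (b := b) (y := y) (c := q) (d := p) (e := p')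
      (f := q') hax.symm hab hby hyq h1.symm hxp.symm hxp' h3 hyq'.symm hxb (hmA q hq).2.2.1.symm
      (hmB q' hq').2.2.1.symm (hmA q hq).2.1.symm (hmB q' hq').2.1.symm
      (fun h => hAB q hq (h ▸ hq')) hay.symm (hmA p hp).1.symm (hmB p' hp').1.symm
      (hmA p hp).2.2.2.1.symm (hmB p' hp').2.2.2.1.symm hpp' fun z => ?_)
    constructor
    · intro hz
      by_cases z1 : z = a
      · simp [z1]
      by_cases z2 : z = b
      · simp [z2]
      by_cases z3 : z = x
      · simp [z3]
      by_cases z4 : z = y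
      · simp [z4]
      rcases hcov' z hz z1 z2 z3 z4 with h | h
      · rcases h2 z h with rfl | rfl <;> simp
      · rcases h4 z h with rfl | rfl <;> simp
    · rintro (rfl | rfl | rfl | rfl | rfl | rfl | rfl | rfl)
      exacts [hxS, haS, hbS, hyS, (hmA _ hq).2.2.2.2, (hmA _ hp).2.2.2.2, (hmB _ hp').2.2.2.2,
        (hmB _ hq').2.2.2.2]
  · have h1 := hK A hsA hA'
    have h2 := hC B hsB hB'
    rw [excess_tableK hA', excess_tableC hB'] at e3
    refine five ?_ (by push_cast at e3; omega)
    have := Nat.mul_le_mul h1 h2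
    exact_mod_cast (by omega : numPM G S ≤ 5)
  · have h1 := hC A hsA hA'
    have h2 := hK B hsB hB'
    rw [excess_tableC hA', excess_tableK hB'] at e3
    refine five ?_ (by push_cast at e3; omega)
    have := Nat.mul_le_mul h1 h2
    exact_mod_cast (by omega : numPM G S ≤ 5)
  · have h1 := hC A hsA hA'
    have h2 := hC B hsB hB'
    rw [excess_tableC hA', excess_tableC hB'] at e3
    have h3 := Nat.mul_le_mul h1 h2
    have h4 : (numPM G S : ℝ) ≤ 8 := by exact_mod_cast (by omega : numPM G S ≤ 8)
    rw [weight_eq_pow (G := G) (S := S) 11 (by push_cast at e3 ⊢; omega), cOne_eq,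
      show (ia ^ 2 + ia ^ 7) * alpha ^ 11 = (ia * alpha) ^ 2 * (alpha ^ 3) ^ 3 +
        (ia * alpha) ^ 7 * (alpha ^ 3 * alpha) by ring, ia_mul_alpha, alpha_pow_three]
    linarith [one_lt_alpha]

end

/-! ### Two adjacent vertices of degree 2 -/

section

variable {V : Type*} {col : V → Bool} {G : SimpleGraph V} {S : Finset V} [Finite V]

/-- The subcase of two adjacent vertices of degree 2 with outer neighbours of degree 3 where the
graph has maximum degree 3. -/
theorem two_chain_cubic (hG : Good col G) (hI : IH col G S) (hS : Conn G S)
    (hJ : ¬IsCopy tableJ G S) (hD : ∀ v ∈ S, (nb G S v).card ≤ 3)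
    {x a b y : V} (ha : nb G S a = {x, b}) (hb : nb G S b = {a, y}) (hxb : x ≠ b) (hay : a ≠ y)
    (hx : (nb G S x).card = 3) (hy : (nb G S y).card = 3)
    (hxT : (nb G ((S.erase a).erase b) x).card = 2) (hyT : (nb G ((S.erase a).erase b) y).card = 2)
    (hT : (numPM G ((S.erase a).erase b) : ℝ) ≤ cOne * weight G ((S.erase a).erase b)) :
    (numPM G S : ℝ) ≤ cOne * weight G S := by
  obtain ⟨hxS, hax⟩ := left_mem_of_nb ha
  obtain ⟨hbS, hab⟩ := right_mem_of_nb ha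
  obtain ⟨haS, -⟩ := left_mem_of_nb hb
  obtain ⟨hyS, hby⟩ := right_mem_of_nb hb
  obtain ⟨e1, e2, e3⟩ := two_chain hG ha hb hxb hay
  have hW := weight_pos G S
  have k2 : col a = col y := hG.col_eq hab hby
  have k6 := hG.ne hab
  have k7 : col x = col b := hG.col_eq hax.symm hab
  have hxy : x ≠ y := fun h => k6 (by rw [k2, ← k7, h])
  have hnxy : ¬G.Adj x y := fun h => hay (hG.c4 hax.symm h hab.symm hby hxb)
  set R := (((S.erase a).erase x).erase b).erase y with hR
  have hsR : R ⊂ S := ssubset_of_erase haS ((Finset.erase_subset _ _).trans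
    ((Finset.erase_subset _ _).trans (Finset.erase_subset _ _)))
  have hmR : ∀ z, z ∈ R ↔ z ≠ y ∧ z ≠ b ∧ z ≠ x ∧ z ≠ a ∧ z ∈ S := fun z => by simp [hR]
  have wT := weight_eq (G := G) (S := S) (H := G) (T := (S.erase a).erase b) 2
    (by rw [e2]; push_cast; omega)
  have wR := weight_eq (G := G) (S := S) (H := G) (T := R) 5
    (by rw [e3, hx, hy]; push_cast; omega)
  have hnba : ∀ z ∈ S, G.Adj z a → z = x ∨ z = b := fun z hz h => by
    have : z ∈ nb G S a := mem_nb.2 ⟨hz, h.symm⟩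
    simpa [ha] using this
  have hnbb : ∀ z ∈ S, G.Adj z b → z = a ∨ z = y := fun z hz h => by
    have : z ∈ nb G S b := mem_nb.2 ⟨hz, h.symm⟩
    simpa [hb] using this
  -- A component of `R` other than `K₂` and the hexagon improves the second summand by the factor
  -- `ia ^ 2 + ia ^ 5`, which suffices.
  by_cases hall : ∀ A, IsClosedIn G R A → Conn G A → IsCopy tableK G A ∨ IsCopy tableC G A
  swap
  · push Not at hall
    obtain ⟨A, hA, hA', hK, hC⟩ := hall
    have h1 := le_of_component hA
      (le_of_proper_component hG hI hS hD (lt_of_le_of_lt hA.1 hsR) hA' hK hC)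
      (hI.le hG (lt_of_le_of_lt Finset.sdiff_subset hsR))
    rw [e1]
    push_cast
    rw [wT] at hT
    rw [wR] at h1
    have h2 : cOne * ia ^ 2 + (ia ^ 2 + ia ^ 5) * ia ^ 5 ≤ cOne := by
      have : cOne * ia ^ 2 + (ia ^ 2 + ia ^ 5) * ia ^ 5 =
        ia ^ 4 + ia ^ 3 * ia ^ 6 + ia ^ 7 + ia ^ 4 * ia ^ 6 := by rw [cOne_eq]; ring
      rw [this, cOne_eq, ia_pow_four, ia_pow_three, ia_pow_six, ia_pow_seven]
      linarith [ia_lt, ia_sq_gt]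
    calc _ ≤ cOne * (ia ^ 2 * weight G S) + (ia ^ 2 + ia ^ 5) * (ia ^ 5 * weight G S) :=
          add_le_add hT h1
      _ = (cOne * ia ^ 2 + (ia ^ 2 + ia ^ 5) * ia ^ 5) * weight G S := by ring
      _ ≤ _ := mul_le_mul_of_nonneg_right h2 hW.le
  obtain ⟨p, p', hpp', hxT'⟩ := Finset.card_eq_two.1 hxT
  obtain ⟨hpT, hxp⟩ := left_mem_of_nb hxT'
  obtain ⟨hpT', hxp'⟩ := right_mem_of_nb hxT'
  simp only [Finset.mem_erase] at hpT hpT'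
  have hpR : p ∈ R := (hmR p).2
    ⟨fun h => hnxy (h ▸ hxp), hpT.1, hxp.ne', hpT.2.1, hpT.2.2⟩
  have hpR' : p' ∈ R := (hmR p').2
    ⟨fun h => hnxy (h ▸ hxp'), hpT'.1, hxp'.ne', hpT'.2.1, hpT'.2.2⟩
  have hcross : ∀ E, IsClosedIn G R E → ∀ u ∈ E, ∀ w ∈ S, w ∉ E → G.Adj u w → w = x ∨ w = y := by
    intro E hE u hu w hw hwE huw
    by_contra hcon
    push Not at hcon
    obtain ⟨m1, m2, m3, m4, m5⟩ := (hmR u).1 (hE.1 hu)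
    refine hwE (hE.2 u hu w ((hmR w).2 ⟨hcon.2, ?_, hcon.1, ?_, hw⟩) huw)
    · rintro rfl
      rcases hnbb u m5 huw with h | h
      exacts [m4 h, m1 h]
    · rintro rfl
      rcases hnba u m5 huw with h | h
      exacts [m3 h, m2 h]
  -- Only `x` and `y` can be joined to `E`, and `x` sends just one edge into it; without edges from
  -- `y`, that edge is a cut edge.
  have hbr : ∀ E, IsClosedIn G R E → Exc G E → ∀ u ∈ E, G.Adj x u → (∀ z ∈ E, ¬G.Adj y z) →
      (numPM G S : ℝ) ≤ cOne * weight G S := by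
    intro E hE hEx u hu hxu hyE
    have hxE : x ∉ E := fun h => ((hmR x).1 (hE.1 h)).2.2.1 rfl
    refine (bridge hG hI (hE.1.trans hsR.subset) hu hxS hxE hxu.symm (by omega) ?_).trans
      (mul_le_mul_of_nonneg_right ia_le_cOne hW.le)
    intro z hz w hw hwE hzw
    rcases hcross E hE z hz w hw hwE hzw with rfl | rfl
    · exact ⟨hEx.eq_of_adj hG hxE hz hu hzw.symm hxu, rfl⟩
    · exact absurd hzw.symm (hyE z hz)
  obtain ⟨A, hpA, hA, hA'⟩ := exists_component G hpR
  obtain ⟨B, hpB, hB, hB'⟩ := exists_component G hpR'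
  have hAk := hall A hA hA'
  have hBk := hall B hB hB'
  have hAe : Exc G A := by unfold Exc; tauto
  have hBe : Exc G B := by unfold Exc; tauto
  have hxA : x ∉ A := fun h => ((hmR x).1 (hA.1 h)).2.2.1 rfl
  have hAB : ∀ z ∈ A, z ∉ B := by
    intro z hz hz'
    have := component_unique hA hB hA' hB' hz hz'
    exact hpp' (hAe.eq_of_adj hG hxA hpA (this ▸ hpB) hxp hxp')
  by_cases hqA : ∃ q ∈ A, G.Adj y q
  swap
  · push Not at hqA
    exact hbr A hA hAe p hpA hxp hqA
  by_cases hqB : ∃ q ∈ B, G.Adj y q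
  swap
  · push Not at hqB
    exact hbr B hB hBe p' hpB hxp' hqB
  obtain ⟨q, hq, hyq⟩ := hqA
  obtain ⟨q', hq', hyq'⟩ := hqB
  have hqq' : q ≠ q' := fun h => hAB q hq (h ▸ hq')
  have hyT' : nb G ((S.erase a).erase b) y = {q, q'} := by
    symm
    refine Finset.eq_of_subset_of_card_le ?_ (by rw [hyT, Finset.card_pair hqq'])
    intro z hz
    simp only [Finset.mem_insert, Finset.mem_singleton] at hz
    rcases hz with rfl | rfl
    · obtain ⟨m1, m2, m3, m4, m5⟩ := (hmR _).1 (hA.1 hq)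
      exact mem_nb.2 ⟨by simp [m2, m4, m5], hyq⟩
    · obtain ⟨m1, m2, m3, m4, m5⟩ := (hmR _).1 (hB.1 hq')
      exact mem_nb.2 ⟨by simp [m2, m4, m5], hyq'⟩
  refine two_parts_bound hG hI hJ ha hb hxb hay hx hy hA hB hAB ?_ hAk hBk hpA hpB hq hq' hxT' hyT'
  have hAR := hA.1
  have hBR := hB.1
  have hnbT : ∀ u w, w ∈ S → G.Adj u w → w = a ∨ w = b ∨ w ∈ nb G ((S.erase a).erase b) u := by
    intro u w hw huw
    by_cases h1 : w = a
    · exact Or.inl h1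
    by_cases h2 : w = b
    · exact Or.inr (Or.inl h2)
    · exact Or.inr (Or.inr (mem_nb.2 ⟨by simp [h1, h2, hw], huw⟩))
  -- All edges at `x` and `y` are now accounted for, so no edge leaves this set and it is the whole
  -- connected graph.
  have hcl : ({x, a, b, y} ∪ (A ∪ B) : Finset V) = S := by
    refine hS.2 _ ⟨?_, ?_⟩ ⟨x, by simp⟩
    · intro z hz
      simp only [Finset.mem_union, Finset.mem_insert, Finset.mem_singleton] at hz
      rcases hz with (rfl | rfl | rfl | rfl) | hz | hz
      exacts [hxS, haS, hbS, hyS, hsR.subset (hAR hz), hsR.subset (hBR hz)]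
    · intro u hu w hw huw
      simp only [Finset.mem_union, Finset.mem_insert, Finset.mem_singleton] at hu ⊢
      rcases hu with (rfl | rfl | rfl | rfl) | hu | hu
      · rcases hnbT _ w hw huw with h | h | h
        · simp [h]
        · simp [h]
        · rw [hxT', Finset.mem_insert, Finset.mem_singleton] at h
          rcases h with rfl | rfl
          · exact Or.inr (Or.inl hpA)
          · exact Or.inr (Or.inr hpB)
      · rcases hnba w hw huw.symm with h | h <;> simp [h]
      · rcases hnbb w hw huw.symm with h | h <;> simp [h]
      · rcases hnbT _ w hw huw with h | h | h
        · simp [h]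
        · simp [h]
        · rw [hyT', Finset.mem_insert, Finset.mem_singleton] at h
          rcases h with rfl | rfl
          · exact Or.inr (Or.inl hq)
          · exact Or.inr (Or.inr hq')
      · by_cases hwA : w ∈ A
        · exact Or.inr (Or.inl hwA)
        · rcases hcross A hA u hu w hw hwA huw with h | h <;> simp [h]
      · by_cases hwB : w ∈ B
        · exact Or.inr (Or.inr hwB)
        · rcases hcross B hB u hu w hw hwB huw with h | h <;> simp [h]
  intro z hz
  obtain ⟨m1, m2, m3, m4, m5⟩ := (hmR z).1 hz
  rw [← hcl] at m5
  simpa [m1, m2, m3, m4] using m5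

/-- Let `C` be the component of `x` after removal of `a` and `b`. If `y` is not in `C`, then `xa` is
a cut edge. If `C` is exceptional, it is all that remains, and it is not `K₂` because `x` has degree
2 there; a hexagon would make `S` a copy of `J`, and `J` is counted directly. Otherwise induction on
`C` improves the first summand. This suffices for `cTwo`, but not for `cOne`, where the second
summand must be improved too (`two_chain_cubic`). -/
theorem two_chain_three (hG : Good col G) (hI : IH col G S) (hS : Conn G S) (hE : ¬Exc G S)
    {x a b y : V} (ha : nb G S a = {x, b}) (hb : nb G S b = {a, y}) (hxb : x ≠ b) (hay : a ≠ y)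
    (hx : (nb G S x).card = 3) (hy : (nb G S y).card = 3) :
    Bnd G S (∀ v ∈ S, (nb G S v).card ≤ 3) := by
  obtain ⟨hxS, hax⟩ := left_mem_of_nb ha
  obtain ⟨hbS, hab⟩ := right_mem_of_nb ha
  obtain ⟨haS, -⟩ := left_mem_of_nb hb
  obtain ⟨hyS, hby⟩ := right_mem_of_nb hb
  obtain ⟨e1, e2, e3⟩ := two_chain hG ha hb hxb hay
  have hW := weight_pos G S
  have k2 : col a = col y := hG.col_eq hab hby
  have k6 := hG.ne hab
  have k7 : col x = col b := hG.col_eq hax.symm hab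
  have hxy : x ≠ y := fun h => k6 (by rw [k2, ← k7, h])
  have hnxy : ¬G.Adj x y := fun h => hay (hG.c4 hax.symm h hab.symm hby hxb)
  have hyb : y ≠ b := hby.ne'
  have hsT : (S.erase a).erase b ⊂ S := ssubset_of_erase haS (Finset.erase_subset _ _)
  have hsR : (((S.erase a).erase x).erase b).erase y ⊂ S :=
    ssubset_of_erase haS ((Finset.erase_subset _ _).trans
      ((Finset.erase_subset _ _).trans (Finset.erase_subset _ _)))
  have hxT : (nb G ((S.erase a).erase b) x).card = 2 := by
    rw [nb_erase_of_not_adj (hG.not_adj k7), nb_erase,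
      Finset.card_erase_of_mem (mem_nb.2 ⟨haS, hax.symm⟩), hx]
  have hyT : (nb G ((S.erase a).erase b) y).card = 2 := by
    rw [nb_erase, nb_erase_of_not_adj (hG.not_adj k2.symm),
      Finset.card_erase_of_mem (mem_nb.2 ⟨hbS, hby.symm⟩), hy]
  have wT := weight_eq (G := G) (S := S) (H := G) (T := (S.erase a).erase b) 2
    (by rw [e2]; push_cast; omega)
  have hxT' : x ∈ (S.erase a).erase b := by simp [hax.ne', hxb, hxS]
  have hyT' : y ∈ (S.erase a).erase b := by simp [hay.symm, hyb, hyS]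
  have hnba : ∀ z ∈ S, G.Adj z a → z = x ∨ z = b := fun z hz h => by
    have : z ∈ nb G S a := mem_nb.2 ⟨hz, h.symm⟩
    simpa [ha] using this
  have hnbb : ∀ z ∈ S, G.Adj z b → z = a ∨ z = y := fun z hz h => by
    have : z ∈ nb G S b := mem_nb.2 ⟨hz, h.symm⟩
    simpa [hb] using this
  obtain ⟨C, hxC, hC, hC'⟩ := exists_component G hxT'
  have haC : a ∉ C := fun h => by simpa using hC.1 h
  have hbC : b ∉ C := fun h => by simpa using hC.1 h
  have hCS : C ⊆ S := hC.1.trans hsT.subset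
  by_cases hyC : y ∈ C
  swap
  · refine Bnd.of_le ia_le_cOne (bridge hG hI hCS hxC haS haC hax.symm (by omega) ?_)
    intro u hu w hw hwC huw
    by_cases hwa : w = a
    · subst hwa
      exact ⟨(hnba u (hCS hu) huw).resolve_right fun h => hbC (h ▸ hu), rfl⟩
    by_cases hwb : w = b
    · subst hwb
      rcases hnbb u (hCS hu) huw with rfl | rfl
      · exact absurd hu haC
      · exact absurd hu hyC
    · exact absurd (hC.2 u hu w (by simp [hwa, hwb, hw]) huw) hwC
  by_cases hCE : Exc G C
  · have hCT : C = (S.erase a).erase b := by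
      by_contra hne
      -- The outer neighbours `x` and `y` of `a` and `b` lie in `C`, so other components of the
      -- remainder would be cut off from the rest of `S`.
      have hcl : IsClosedIn G S (((S.erase a).erase b) \ C) := by
        refine ⟨Finset.sdiff_subset.trans hsT.subset, fun u hu w hw huw => ?_⟩
        have hu' := hsT.subset (Finset.mem_sdiff.1 hu).1
        have huC := (Finset.mem_sdiff.1 hu).2
        have hu'' : u ≠ b ∧ u ≠ a ∧ u ∈ S := by simpa using (Finset.mem_sdiff.1 hu).1
        refine hC.compl.2 u hu w ?_ huw
        simp only [Finset.mem_erase]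
        refine ⟨?_, ?_, hw⟩
        · rintro rfl
          rcases hnbb u hu' huw with rfl | rfl
          · exact hu''.2.1 rfl
          · exact huC hyC
        · rintro rfl
          rcases hnba u hu' huw with rfl | rfl
          · exact huC hxC
          · exact hu''.1 rfl
      have hne' : (((S.erase a).erase b) \ C).Nonempty := by
        rw [Finset.sdiff_nonempty]
        exact fun h => hne (hC.1.antisymm h)
      have := hS.2 _ hcl hne'
      rw [← this] at haS
      simp at haS
    rw [hCT] at hCE
    rcases hCE with h | h | h
    · rw [card_nb_tableK h hxT'] at hxT
      omega
    · refine absurd (Or.inr (Or.inr ?_)) hE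
      exact isCopy_tableJ_of_hexagon hG h hxT' hyT' hnxy (fun h => k6 (by rw [k2, ← k7, h])) haS
        hbS hax.symm hab hby
    -- Here `S` has weight `α ^ 7`: the `J` summand is at most `α ^ 5`, the other at most 1, and `α
    -- ^ 5 + 1 = cOne * α ^ 7`.
    · rw [excess_tableJ h] at e2
      refine Bnd.of_le le_rfl ?_
      have h1 := hI.le hG hsT
      have h2 : numPM G ((((S.erase a).erase x).erase b).erase y) ≤ 1 :=
        numPM_le_one (hI.le hG hsR) (by rw [e3, hx, hy]; push_cast; omega)
      have h3 : ia ^ 7 * weight G S = 1 := by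
        rw [weight_eq_pow (G := G) (S := S) 7 (by push_cast; omega), ← mul_pow, ia_mul_alpha,
          one_pow]
      have h4 : (numPM G ((((S.erase a).erase x).erase b).erase y) : ℝ) ≤ 1 := by exact_mod_cast h2
      rw [e1, cOne_eq, add_mul, h3, ← wT]
      push_cast
      exact add_le_add h1 h4
  · have hB := Bnd.of_component hG hI hsT hC hC'
      ⟨x, hxC, by rw [hC.nb_eq hxC, hxT]⟩ hCE
    constructor
    · have h1 := hB.1
      have h2 := (hI.le hG hsR).trans (weight_le (G := G) (S := S) 5
        (by rw [e3, hx, hy]; push_cast; omega))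
      rw [wT] at h1
      rw [e1]
      push_cast
      have h3 : cTwo * ia ^ 2 + ia ^ 5 ≤ cTwo := by
        have : cTwo * ia ^ 2 = ia ^ 5 + ia ^ 6 := by rw [cTwo_eq]; ring
        rw [this, cTwo_eq, ia_pow_three, ia_pow_four, ia_pow_five, ia_pow_six]
        linarith [ia_gt, ia_sq_lt]
      calc _ ≤ cTwo * (ia ^ 2 * weight G S) + ia ^ 5 * weight G S := add_le_add h1 h2
        _ = (cTwo * ia ^ 2 + ia ^ 5) * weight G S := by ring
        _ ≤ _ := mul_le_mul_of_nonneg_right h3 hW.le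
    · intro hD
      exact two_chain_cubic hG hI hS (fun h => hE (Or.inr (Or.inr h))) hD ha hb hxb hay hx hy hxT
        hyT (hB.2 hD)

theorem two_chain_bound (hG : Good col G) (hI : IH col G S) (hS : Conn G S) (hE : ¬Exc G S)
    (hmin : ∀ v ∈ S, 2 ≤ (nb G S v).card) {x a b y : V} (ha : nb G S a = {x, b})
    (hb : nb G S b = {a, y}) (hxb : x ≠ b) (hay : a ≠ y) :
    Bnd G S (∀ v ∈ S, (nb G S v).card ≤ 3) := by
  obtain ⟨hxS, hax⟩ := left_mem_of_nb ha
  obtain ⟨hbS, hab⟩ := right_mem_of_nb ha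
  obtain ⟨haS, -⟩ := left_mem_of_nb hb
  obtain ⟨hyS, hby⟩ := right_mem_of_nb hb
  have hC : ¬IsCopy tableC G S := fun h => hE (Or.inr (Or.inl h))
  rcases (hmin y hyS).eq_or_lt with hy | hy
  · obtain ⟨z, hz, hz'⟩ := eq_pair_of_card hy.symm (mem_nb.2 ⟨hbS, hby.symm⟩)
    exact three_chain_bound hG hI hS hmin hC ha hb hz hxb hay hz'
  rcases (hmin x hxS).eq_or_lt with hx | hx
  · obtain ⟨z, hz, hz'⟩ := eq_pair_of_card hx.symm (mem_nb.2 ⟨haS, hax.symm⟩)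
    rw [Finset.pair_comm] at hz
    exact three_chain_bound hG hI hS hmin hC hz ha hb hz'.symm hxb hay
  by_cases h33 : (nb G S x).card = 3 ∧ (nb G S y).card = 3
  · exact two_chain_three hG hI hS hE ha hb hxb hay h33.1 h33.2
  -- The outer degrees sum to at least 7, so the gains are 2 and at least 6; the bound for maximum
  -- degree 3 is vacuous.
  · obtain ⟨e1, e2, e3⟩ := two_chain hG ha hb hxb hay
    refine ⟨?_, fun hD => absurd ⟨le_antisymm (hD x hxS) hx, le_antisymm (hD y hyS) hy⟩ h33⟩
    refine (le_add_of_excess hI hG (ssubset_of_erase haS (Finset.erase_subset _ _))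
      (ssubset_of_erase haS ((Finset.erase_subset _ _).trans
      ((Finset.erase_subset _ _).trans (Finset.erase_subset _ _)))) e1 2 6
      (by rw [e2]; push_cast; omega) (by rw [e3]; push_cast; omega)).trans
      (mul_le_mul_of_nonneg_right ?_ (weight_pos G S).le)
    rw [cTwo_eq, ia_pow_six, ia_pow_three, ia_pow_four]
    linarith [ia_gt, ia_sq_lt]

/-- The bounds for connected graphs with a vertex of degree at most 2. -/
theorem bnd_of_low (hG : Good col G) (hI : IH col G S) (hS : Conn G S) (hE : ¬Exc G S)
    (hlow : ∃ v ∈ S, (nb G S v).card ≤ 2) : Bnd G S (∀ v ∈ S, (nb G S v).card ≤ 3) := by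
  by_cases hmin : ∀ v ∈ S, 2 ≤ (nb G S v).card
  swap
  · push Not at hmin
    obtain ⟨v, hv, h⟩ := hmin
    exact Bnd.of_leaf hG hI hS (fun h => hE (Or.inl h)) hv (Nat.lt_succ_iff.1 h)
  obtain ⟨v, hvS, hv⟩ := hlow
  obtain ⟨p, q, hpq, hnb⟩ := Finset.card_eq_two.1 (le_antisymm hv (hmin v hvS))
  obtain ⟨hpS, hvp⟩ := left_mem_of_nb hnb
  obtain ⟨hqS, hvq⟩ := right_mem_of_nb hnb
  rcases (hmin q hqS).eq_or_lt with hq | hq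
  · obtain ⟨z, hz, hz'⟩ := eq_pair_of_card hq.symm (mem_nb.2 ⟨hvS, hvq.symm⟩)
    exact two_chain_bound hG hI hS hE hmin hnb hz hpq hz'
  rcases (hmin p hpS).eq_or_lt with hp | hp
  · obtain ⟨z, hz, hz'⟩ := eq_pair_of_card hp.symm (mem_nb.2 ⟨hvS, hvp.symm⟩)
    rw [Finset.pair_comm] at hnb
    exact two_chain_bound hG hI hS hE hmin hnb hz hpq.symm hz'
  · exact single_bound hG hI hnb hvS hpq hp hq

end

/-! ### The bound `α ^ k` and the end of the induction -/

section

variable {V : Type*} {col : V → Bool} {G : SimpleGraph V} {S : Finset V}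

theorem succ_mul_ia_pow_le_one (d : ℕ) (hd : 4 ≤ d) : (d : ℝ) * ia ^ (2 * d - 2) ≤ 1 := by
  induction d, hd using Nat.le_induction with
  | base => norm_num [ia_pow_six]
  | succ d hd ih =>
    have h1 : 2 * (d + 1) - 2 = (2 * d - 2) + 2 := by omega
    have h2 : (4 : ℝ) ≤ d := by exact_mod_cast hd
    have h3 : ((d : ℝ) + 1) * ia ^ 2 ≤ d := by nlinarith [ia_sq_lt]
    rw [h1, pow_add]
    push_cast
    have h4 : 0 ≤ ia ^ (2 * d - 2) := pow_nonneg ia_pos.le _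
    nlinarith [mul_le_mul_of_nonneg_right h3 h4]

/-- Each remaining vertex is adjacent to at most one of `v`, `w`, so it keeps degree at least 2, and
a vertex of degree 2 was adjacent to `v` or `w`. Two such vertices of the same colour were adjacent
to the same end, which would then send two edges into an exceptional part. By `Exc.low` every
exceptional graph has a leaf or two such vertices. -/
theorem not_exc_of_erase_pair (hG : Good col G) (hmin : ∀ z ∈ S, 3 ≤ (nb G S z).card) {v w : V}
    (hvw : G.Adj v w) {C : Finset V} (hC : IsClosedIn G ((S.erase v).erase w) C) :
    ¬Exc G C := by
  intro hE
  have hvC : v ∉ C := fun h => by simpa [hvw.ne] using hC.1 h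
  have hwC : w ∉ C := fun h => by simpa using hC.1 h
  have hCS : C ⊆ S := hC.1.trans ((Finset.erase_subset _ _).trans (Finset.erase_subset _ _))
  have hdeg : ∀ z ∈ C, 2 ≤ (nb G C z).card ∧ ((nb G C z).card ≤ 2 → G.Adj z v ∨ G.Adj z w) := by
    intro z hz
    rw [hC.nb_eq hz]
    have h3 := hmin z (hCS hz)
    by_cases h1 : G.Adj z v
    · have h2 : ¬G.Adj z w := fun h => hG.ne hvw (hG.col_eq h1.symm h)
      rw [nb_erase_of_not_adj h2, nb_erase]
      have := Finset.pred_card_le_card_erase (s := nb G S z) (a := v)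
      exact ⟨by omega, fun _ => Or.inl h1⟩
    · rw [nb_erase, nb_erase_of_not_adj h1]
      have := Finset.pred_card_le_card_erase (s := nb G S z) (a := w)
      refine ⟨by omega, fun h => Or.inr (by_contra fun h2 => ?_)⟩
      rw [Finset.erase_eq_of_notMem fun h' => h2 (mem_nb.1 h').2] at h
      omega
  rcases hE.low hG with ⟨a, ha, h⟩ | ⟨a, ha, b, hb, hab, hcol, h1, h2⟩
  · have := (hdeg a ha).1
    omega
  · have hvw' : ∀ a b : V, col a = col b → G.Adj a v → G.Adj b w → False := fun a b hcol h h' => by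
      have h1 := hG.ne h
      have h2 := hG.ne h'
      have h3 := hG.ne hvw
      cases hv : col v <;> cases hw : col w <;> cases hb : col b <;> simp_all
    rcases (hdeg a ha).2 h1 with h | h <;> rcases (hdeg b hb).2 h2 with h' | h'
    · exact hab (hE.eq_of_adj hG hvC ha hb h.symm h'.symm)
    · exact hvw' a b hcol h h'
    · exact hvw' b a hcol.symm h' h
    · exact hab (hE.eq_of_adj hG hwC ha hb h.symm h'.symm)

variable [Finite V]

/-- With the constant 1 the direct expansions suffice, notably through `2 * ia ^ 3 = 1`, so
exceptional graphs need no separate treatment. -/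
theorem le_weight_of_low (hG : Good col G) (hI : IH col G S)
    (hlow : ∃ v ∈ S, (nb G S v).card ≤ 2) : (numPM G S : ℝ) ≤ weight G S := by
  have hW := weight_pos G S
  have hle : ∀ {c : ℝ}, c ≤ 1 → (numPM G S : ℝ) ≤ c * weight G S →
      (numPM G S : ℝ) ≤ weight G S := fun hc h =>
    h.trans ((mul_le_mul_of_nonneg_right hc hW.le).trans (one_mul _).le)
  by_cases hmin : ∀ v ∈ S, 2 ≤ (nb G S v).card
  swap
  · push Not at hmin
    obtain ⟨v, hv, h⟩ := hmin
    rcases Nat.le_one_iff_eq_zero_or_eq_one.1 (Nat.lt_succ_iff.1 h) with h0 | h1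
    · rw [numPM_eq_zero hv (Finset.card_eq_zero.1 h0)]
      simpa using hW.le
    · obtain ⟨u, hu⟩ := Finset.card_eq_one.1 h1
      obtain ⟨huS, hvu⟩ := mem_nb.1 (show u ∈ nb G S v by simp [hu])
      obtain ⟨h2, h3⟩ := leaf_excess hv hu
      have hpos := Finset.card_pos.2 ⟨v, mem_nb.2 ⟨hv, hvu.symm⟩⟩
      rw [h2]
      refine (hI.le hG (ssubset_of_erase hv (Finset.erase_subset _ _))).trans ?_
      simpa using weight_le (G := G) (S := S) (H := G) (T := (S.erase v).erase u) 0
        (by push_cast; omega)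
  have h33 : ia ^ 3 + ia ^ 3 ≤ 1 := by rw [ia_pow_three]; norm_num
  have chain : ∀ {x a b y : V}, nb G S a = {x, b} → nb G S b = {a, y} → x ≠ b → a ≠ y →
      (numPM G S : ℝ) ≤ weight G S := by
    intro x a b y ha hb hxb hay
    obtain ⟨hxS, hax⟩ := left_mem_of_nb ha
    obtain ⟨hbS, hab⟩ := right_mem_of_nb ha
    obtain ⟨haS, -⟩ := left_mem_of_nb hb
    obtain ⟨hyS, hby⟩ := right_mem_of_nb hb
    rcases (hmin y hyS).eq_or_lt with hy | hy
    · obtain ⟨z, hz, hz'⟩ := eq_pair_of_card hy.symm (mem_nb.2 ⟨hbS, hby.symm⟩)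
      exact hle h33 (three_chain hG hI ha hb hz hxb hay hz' 2 2 (hmin x hxS)
        (hmin z (right_mem_of_nb hz).1))
    rcases (hmin x hxS).eq_or_lt with hx | hx
    · obtain ⟨z, hz, hz'⟩ := eq_pair_of_card hx.symm (mem_nb.2 ⟨haS, hax.symm⟩)
      rw [Finset.pair_comm] at hz
      exact hle h33 (three_chain hG hI hz ha hb hz'.symm hxb hay 2 2
        (hmin z (left_mem_of_nb hz).1) (hmin y hyS))
    obtain ⟨e1, e2, e3⟩ := two_chain hG ha hb hxb hay
    refine hle ?_ (le_add_of_excess hI hG (ssubset_of_erase haS (Finset.erase_subset _ _))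
      (ssubset_of_erase haS ((Finset.erase_subset _ _).trans
      ((Finset.erase_subset _ _).trans (Finset.erase_subset _ _)))) e1 2 5
      (by rw [e2]; push_cast; omega) (by rw [e3]; push_cast; omega))
    rw [ia_pow_five]
    linarith [ia_sq_lt]
  obtain ⟨v, hvS, hv⟩ := hlow
  obtain ⟨p, q, hpq, hnb⟩ := Finset.card_eq_two.1 (le_antisymm hv (hmin v hvS))
  obtain ⟨hpS, hvp⟩ := left_mem_of_nb hnb
  obtain ⟨hqS, hvq⟩ := right_mem_of_nb hnb
  have hnb' := hnb
  rw [Finset.pair_comm] at hnb'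
  rcases (hmin q hqS).eq_or_lt with hq | hq
  · obtain ⟨z, hz, hz'⟩ := eq_pair_of_card hq.symm (mem_nb.2 ⟨hvS, hvq.symm⟩)
    exact chain hnb hz hpq hz'
  rcases (hmin p hpS).eq_or_lt with hp | hp
  · obtain ⟨z, hz, hz'⟩ := eq_pair_of_card hp.symm (mem_nb.2 ⟨hvS, hvp.symm⟩)
    exact chain hnb' hz hpq.symm hz'
  · refine hle h33 (le_add_of_excess hI hG (ssubset_of_erase hvS (Finset.erase_subset _ _))
      (ssubset_of_erase hvS (Finset.erase_subset _ _)) (numPM_pair hvS hnb hpq) 3 3 ?_ ?_)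
    · rw [excess_erase_pair_of_deg_two hnb hvS hpq]; push_cast; omega
    · rw [excess_erase_pair_of_deg_two hnb' hvS hpq.symm]; push_cast; omega

/-- Expansion along a vertex with a uniform bound for the terms. -/
theorem le_of_expand {v : V} (hv : v ∈ S) {c : ℝ}
    (h : ∀ w ∈ nb G S v, (numPM G ((S.erase v).erase w) : ℝ) ≤ c) :
    (numPM G S : ℝ) ≤ (nb G S v).card * c := by
  rw [numPM_expand G hv]
  push_cast
  exact (Finset.sum_le_sum h).trans (by rw [Finset.sum_const, nsmul_eq_mul])

/-- Expanding at a vertex of minimum degree `d` gives `d` summands, each with gain at least `2 * d -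
2`. -/
theorem le_weight_of_four_le (hG : Good col G) (hI : IH col G S)
    (hmin : ∀ v ∈ S, 4 ≤ (nb G S v).card) : (numPM G S : ℝ) ≤ weight G S := by
  rcases S.eq_empty_or_nonempty with rfl | hne
  · rw [numPM_empty, weight_eq_pow 0 (by simp [excess])]
    simp
  obtain ⟨v, hv, hvmin⟩ := Finset.exists_min_image S (fun v => (nb G S v).card) hne
  have h4 := hmin v hv
  refine (le_of_expand hv (c := ia ^ (2 * (nb G S v).card - 2) * weight G S) fun w hw => ?_).trans
    ?_
  · refine (hI.le hG (ssubset_of_erase hv (Finset.erase_subset _ _))).trans (weight_le _ ?_)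
    rw [excess_pair hv hw]
    have := hvmin w (mem_nb.1 hw).1
    push_cast [show 2 ≤ 2 * (nb G S v).card by omega]
    omega
  · rw [← mul_assoc]
    exact (mul_le_mul_of_nonneg_right (succ_mul_ia_pow_le_one _ h4) (weight_pos G S).le).trans
      (one_mul _).le

/-- Bounds after removing an edge together with its ends, in a graph of minimum degree 3. -/
theorem Bnd.of_erase_pair (hG : Good col G) (hI : IH col G S)
    (hmin : ∀ z ∈ S, 3 ≤ (nb G S z).card) {u v w : V} (hu : u ∈ S) (huv : G.Adj u v)
    (huw : G.Adj u w) (hwv : w ≠ v) (hw : w ∈ S) (hw3 : (nb G S w).card = 3) :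
    Bnd G ((S.erase u).erase v) (∀ v ∈ S, (nb G S v).card ≤ 3) := by
  have hwT : w ∈ (S.erase u).erase v := by simp [hwv, huw.ne', hw]
  have hcol : col w = col v := hG.col_eq huw.symm huv
  obtain ⟨C, hwC, hC, hC'⟩ := exists_component G hwT
  refine Bnd.of_component hG hI (ssubset_of_erase hu (Finset.erase_subset _ _)) hC hC'
    ⟨w, hwC, ?_⟩ (not_exc_of_erase_pair hG hmin huv hC)
  rw [hC.nb_eq hwC, nb_erase_of_not_adj (hG.not_adj hcol), nb_erase,
    Finset.card_erase_of_mem (mem_nb.2 ⟨hu, huw.symm⟩), hw3]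

/-- Each of the three summands has gain 4. Another neighbour of `v` keeps degree 2 in it, so the
induction also supplies `cOne`. -/
theorem le_weight_of_cubic (hG : Good col G) (hI : IH col G S)
    (hcub : ∀ z ∈ S, (nb G S z).card = 3) {v : V} (hv : v ∈ S) :
    (numPM G S : ℝ) ≤ weight G S := by
  refine (le_of_expand hv (c := cOne * (ia ^ 4 * weight G S)) fun w hw => ?_).trans ?_
  · obtain ⟨hwS, hvw⟩ := mem_nb.1 hw
    obtain ⟨w', hw', hne⟩ := Finset.exists_mem_ne (s := nb G S v)
      (by rw [hcub v hv]; norm_num) w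
    obtain ⟨hwS', hvw'⟩ := mem_nb.1 hw'
    have h := (Bnd.of_erase_pair hG hI (fun z hz => (hcub z hz).ge) hv hvw hvw' hne hwS'
      (hcub w' hwS')).2 fun z hz => (hcub z hz).le
    rwa [weight_eq (G := G) (S := S) (H := G) (T := (S.erase v).erase w) 4
      (by rw [excess_pair hv hw, hcub v hv, hcub w hwS]; norm_num)] at h
  · rw [hcub v hv, ← mul_assoc, ← mul_assoc]
    refine (mul_le_mul_of_nonneg_right ?_ (weight_pos G S).le).trans (one_mul _).le
    have : ((3 : ℕ) : ℝ) * cOne * ia ^ 4 = 3 * ia ^ 6 + 3 * (ia ^ 6 * ia ^ 5) := by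
      rw [cOne_eq]; push_cast; ring
    rw [this, ia_pow_six, ia_pow_five]
    linarith [ia_sq_lt]

/-- If all neighbours of `u` have degree at least 4, then `3 * ia ^ 5 ≤ 1` suffices. Otherwise split
according to the edge `uv`. Without the edge, `u` has degree 2; without both ends, a cubic neighbour
`w` of `u` has degree 2. So `cTwo` applies to both summands, with gains 1 and 5. -/
theorem le_weight_of_three_four (hG : Good col G) (hI : IH col G S)
    (hmin : ∀ z ∈ S, 3 ≤ (nb G S z).card) {u v : V} (hu : u ∈ S) (hv : v ∈ S) (huv : G.Adj u v)
    (hu3 : (nb G S u).card = 3) (hv4 : 4 ≤ (nb G S v).card) :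
    (numPM G S : ℝ) ≤ weight G S := by
  have hW := weight_pos G S
  by_cases hall : ∀ w ∈ nb G S u, 4 ≤ (nb G S w).card
  · refine (le_of_expand hu (c := ia ^ 5 * weight G S) fun w hw => ?_).trans ?_
    · refine (hI.le hG (ssubset_of_erase hu (Finset.erase_subset _ _))).trans (weight_le 5 ?_)
      rw [excess_pair hu hw, hu3]
      have := hall w hw
      push_cast; omega
    · rw [hu3, ← mul_assoc]
      refine (mul_le_mul_of_nonneg_right ?_ hW.le).trans (one_mul _).le
      rw [ia_pow_five]
      push_cast
      linarith [ia_sq_lt]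
  push Not at hall
  obtain ⟨w, hw, hw3⟩ := hall
  obtain ⟨hwS, huw⟩ := mem_nb.1 hw
  have hwv : w ≠ v := fun h => by rw [h] at hw3; omega
  have h2 := (Bnd.of_erase_pair hG hI hmin hu huv huw hwv hwS
    (le_antisymm (by omega) (hmin w hwS))).1
  have w2 := weight_le (G := G) (S := S) (H := G) (T := (S.erase u).erase v) 5
    (by rw [excess_pair hu (mem_nb.2 ⟨hv, huv⟩), hu3]; push_cast; omega)
  have w1 := weight_eq (G := G) (S := S) (H := del G u v) (T := S) 1
    (by rw [excess_del hu hv huv]; push_cast; omega)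
  have hG' := hG.del u v
  have hlt := size_del_lt hu hv huv
  obtain ⟨C, huC, hC, hC'⟩ := exists_component (del G u v) hu
  have hdu : (nb (del G u v) S u).card = 2 := by
    rw [nb_del_left S huv, Finset.card_erase_of_mem (mem_nb.2 ⟨hv, huv⟩), hu3]
  have hdeg : ∀ z ∈ C, z ≠ u → 3 ≤ (nb (del G u v) C z).card := by
    intro z hz hzu
    rw [hC.nb_eq hz]
    by_cases hzv : z = v
    · subst hzv
      rw [nb_del_right S huv, Finset.card_erase_of_mem (mem_nb.2 ⟨hu, huv.symm⟩)]
      omega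
    · rw [nb_del_of_ne S hzu hzv]
      exact hmin z (hC.1 hz)
  -- In `C` only `u` has degree below 3, whereas an exceptional graph has a leaf or two vertices of
  -- degree at most 2.
  have hE : ¬Exc (del G u v) C := by
    intro hE
    rcases hE.low hG' with ⟨a, ha, h⟩ | ⟨a, ha, b, hb, hab, -, h1, h2⟩
    · by_cases hau : a = u
      · rw [hau, hC.nb_eq huC, hdu] at h
        omega
      · have := hdeg a ha hau
        omega
    · by_cases hau : a = u
      · have := hdeg b hb fun h => hab (hau.trans h.symm)
        omega
      · have := hdeg a ha hau
        omega
  have h1 : (numPM (del G u v) S : ℝ) ≤ cTwo * weight (del G u v) S :=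
    le_of_component hC ((hI _ C hG' ((size_mono hC.1).trans_lt hlt)).c hC'
      ⟨u, huC, by rw [hC.nb_eq huC, hdu]⟩ hE)
      (hI _ _ hG' ((size_mono Finset.sdiff_subset).trans_lt hlt)).a
  have hc : 0 ≤ cTwo := by
    rw [cTwo_eq]
    have := ia_pos
    positivity
  rw [numPM_del hu hv huv]
  push_cast
  rw [w1, pow_one] at h1
  have h3 : cTwo * ia + cTwo * ia ^ 5 ≤ 1 := by
    have : cTwo * ia + cTwo * ia ^ 5 = ia ^ 4 + ia ^ 5 + ia ^ 3 * ia ^ 5 + ia ^ 3 * ia ^ 6 := by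
      rw [cTwo_eq]; ring
    rw [this, ia_pow_three, ia_pow_four, ia_pow_five, ia_pow_six]
    linarith [ia_lt, ia_sq_lt]
  calc _ ≤ cTwo * (ia * weight G S) + cTwo * (ia ^ 5 * weight G S) :=
        add_le_add h1 (h2.trans (mul_le_mul_of_nonneg_left w2 hc))
    _ = (cTwo * ia + cTwo * ia ^ 5) * weight G S := by ring
    _ ≤ 1 * weight G S := mul_le_mul_of_nonneg_right h3 hW.le
    _ = _ := one_mul _

theorem le_weight (hG : Good col G) (hI : IH col G S) : (numPM G S : ℝ) ≤ weight G S := by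
  by_cases hlow : ∃ v ∈ S, (nb G S v).card ≤ 2
  · exact le_weight_of_low hG hI hlow
  push Not at hlow
  by_cases hfour : ∀ v ∈ S, 4 ≤ (nb G S v).card
  · exact le_weight_of_four_le hG hI hfour
  push Not at hfour
  obtain ⟨v, hv, hv3⟩ := hfour
  by_cases hconn : ∀ A, IsClosedIn G S A → A.Nonempty → A = S
  · by_cases hcub : ∀ z ∈ S, (nb G S z).card = 3
    · exact le_weight_of_cubic hG hI hcub hv
    -- By connectedness, some edge joins a cubic vertex to one of larger degree.
    · have hcl : ¬IsClosedIn G S (S.filter fun z => (nb G S z).card = 3) := fun hcl => by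
        refine hcub fun z hz => ?_
        rw [← hconn _ hcl ⟨v, Finset.mem_filter.2 ⟨hv, by have := hlow v hv; omega⟩⟩] at hz
        exact (Finset.mem_filter.1 hz).2
      simp only [IsClosedIn, Finset.filter_subset, true_and, Finset.mem_filter] at hcl
      push Not at hcl
      obtain ⟨a, ⟨ha, ha3⟩, b, hb, hab, hb3⟩ := hcl
      have := hlow b hb
      have := hb3 hb
      exact le_weight_of_three_four hG hI (fun z hz => hlow z hz) ha hb hab ha3 (by omega)
  · push Not at hconn
    obtain ⟨A, hA, hne, hAS⟩ := hconn
    have hs : S \ A ⊂ S := Finset.sdiff_ssubset hA.1 hne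
    rw [numPM_mul G hA, hA.weight_mul]
    push_cast
    exact mul_le_mul (hI.le hG (hA.1.ssubset_of_ne hAS)) (hI.le hG hs) (Nat.cast_nonneg _)
      (weight_pos _ _).le

theorem holds (hG : Good col G) : Holds G S := by
  induction hn : size G S using Nat.strong_induction_on generalizing G S with
  | _ n ih =>
    have hI : IH col G S := fun H T hH hlt => ih _ (hn ▸ hlt) hH rfl
    exact ⟨le_weight hG hI, fun h1 h2 h3 h4 => (bnd_of_low hG hI h1 h4 h2).2 h3,
      fun h1 h2 h3 => (bnd_of_low hG hI h1 h3 h2).1⟩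

end

/-! ### Transfer to graphs on a finite vertex type -/

section

variable {V : Type*} {col : V → Bool} {G : SimpleGraph V}

theorem good_of_isBipartiteWith {s t : Set V} (h : G.IsBipartiteWith s t)
    (hC : (SimpleGraph.cycleGraph 4).Free G) : Good (fun v => decide (v ∈ s)) G := by
  refine ⟨fun {u v} huv => ?_, fun {u v a b} h1 h2 h3 h4 huv => by_contra fun hab => hC ?_⟩
  · rcases h.mem_of_adj huv with ⟨h1, h2⟩ | ⟨h1, h2⟩
    · simp [h1, Set.disjoint_right.1 h.disjoint h2]
    · simp [h2, Set.disjoint_right.1 h.disjoint h1]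
  · refine ⟨⟨⟨![u, a, v, b], ?_⟩, ?_⟩⟩
    · have := h1.symm; have := h2.symm; have := h3.symm; have := h4.symm
      intro i j hij
      have : i = j + 1 ∨ j = i + 1 := by
        revert i j; decide
      fin_cases i <;> fin_cases j <;> first | (exfalso; revert this; decide) | simpa
    · rw [← List.nodup_ofFn]
      have := h1.ne; have := h2.ne; have := h3.ne; have := h4.ne
      simp
      grind

theorem conn_univ [Fintype V] (h : G.Connected) : Conn G Finset.univ := by
  obtain ⟨v⟩ := h.nonempty
  refine ⟨⟨v, Finset.mem_univ v⟩, fun A hA ⟨a, ha⟩ => ?_⟩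
  ext b
  simp only [Finset.mem_univ, iff_true]
  obtain ⟨w⟩ := h.preconnected a b
  induction w with
  | nil => exact ha
  | cons hadj _ ih => exact ih (hA.2 _ ha _ (Finset.mem_univ _) hadj)

/-- The perfect matching subgraph given by an involution. -/
def involutionSubgraph (G : SimpleGraph V) (f : V → V) (h : ∀ v, G.Adj v (f v))
    (hf : ∀ v, f (f v) = v) : G.Subgraph where
  verts := Set.univ
  Adj u v := f u = v
  adj_sub := by rintro u v rfl; exact h u
  edge_vert _ := Set.mem_univ _
  symm := ⟨by rintro u v rfl; exact hf u⟩

theorem perm_eq_numPM [Fintype V] (G : SimpleGraph V) : perm G = numPM G Finset.univ := by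
  symm
  unfold perm numPM
  refine Set.ncard_congr (fun f hf => involutionSubgraph G f
    (fun v => hf.1 v (Finset.mem_univ v)) hf.2.2) ?_ ?_ ?_
  · intro f hf
    rw [Set.mem_ofPred_eq, SimpleGraph.Subgraph.isPerfectMatching_iff]
    exact fun v => ⟨f v, rfl, fun w hw => Eq.symm hw⟩
  · intro f g hf hg h
    funext v
    have h1 : (involutionSubgraph G f (fun v => hf.1 v (Finset.mem_univ v)) hf.2.2).Adj v (f v) :=
      rfl
    rw [h] at h1
    exact Eq.symm h1
  · intro M hM
    have hM' := SimpleGraph.Subgraph.isPerfectMatching_iff.1 hM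
    choose f hf hf' using hM'
    refine ⟨f, ⟨fun v _ => M.adj_sub (hf v), fun v hv => absurd (Finset.mem_univ v) hv,
      fun v => ((hf' (f v)) v (hf v).symm).symm⟩, ?_⟩
    ext u v
    · exact ⟨fun _ => hM.2 u, fun _ => Set.mem_univ u⟩
    · exact ⟨fun h => by rw [← show f u = v from h]; exact hf u, fun h => (hf' u v h).symm⟩

theorem card_nb_univ [Fintype V] [DecidableRel G.Adj] (v : V) :
    (nb G Finset.univ v).card = G.degree v := by
  rw [← SimpleGraph.card_neighborFinset_eq_degree]
  congr 1
  ext w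
  simp [mem_nb]

theorem excess_univ [Fintype V] [DecidableRel G.Adj] :
    excess G Finset.univ = 2 * (G.edgeSet.ncard : ℤ) - Fintype.card V := by
  unfold excess
  simp only [card_nb_univ]
  rw [Finset.sum_sub_distrib, ← Nat.cast_sum, SimpleGraph.sum_degrees_eq_twice_card_edges,
    ← SimpleGraph.coe_edgeFinset, Set.ncard_coe_finset]
  simp

theorem nonempty_iso_of_isCopy [Fintype V] {m : ℕ} {N : Fin m → Finset (Fin m)}
    (h : IsCopy N G Finset.univ) {H : SimpleGraph (Fin m)} (hH : ∀ i j, H.Adj i j ↔ j ∈ N i) :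
    Nonempty (G ≃g H) := by
  obtain ⟨f, hf, hS, h⟩ := h
  have hsurj : Function.Surjective f := fun v => by
    have : v ∈ Finset.univ.image f := by rw [hS]; simp
    simpa using this
  refine ⟨SimpleGraph.Iso.symm ⟨Equiv.ofBijective f ⟨hf, hsurj⟩, fun {i j} => ?_⟩⟩
  rw [hH, ← h]
  rfl

theorem not_exc_univ [Fintype V] (h₁ : IsEmpty (G ≃g SimpleGraph.completeGraph (Fin 2)))
    (h₂ : IsEmpty (G ≃g SimpleGraph.cycleGraph 6)) (h₃ : IsEmpty (G ≃g graphJ)) :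
    ¬Exc G Finset.univ := by
  rintro (h | h | h)
  · obtain ⟨e⟩ := nonempty_iso_of_isCopy h (H := SimpleGraph.completeGraph (Fin 2))
      (by simp only [SimpleGraph.completeGraph, SimpleGraph.top_adj]; decide)
    exact h₁.false e
  · obtain ⟨e⟩ := nonempty_iso_of_isCopy h (H := SimpleGraph.cycleGraph 6)
      (by simp only [SimpleGraph.cycleGraph_adj]; decide)
    exact h₂.false e
  · obtain ⟨e⟩ := nonempty_iso_of_isCopy h (H := graphJ) (by
      simp only [graphJ, SimpleGraph.fromEdgeSet_adj, Set.mem_insert_iff, Set.mem_singleton_iff]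
      decide)
    exact h₃.false e

theorem card_eq_of_isBalancedBipartite [Fintype V] {s t : Set V} {n : ℕ} (hd : Disjoint s t)
    (hst : s ∪ t = Set.univ) (hs : s.encard = n) (ht : t.encard = n) :
    Fintype.card V = 2 * n := by
  have h := Set.encard_union_eq hd
  rw [hst, Set.encard_univ, hs, ht, ENat.card_eq_coe_fintype_card] at h
  have h' : Fintype.card V = n + n := by exact_mod_cast h
  omega

theorem cOne_le_inv : cOne ≤ (3 * alpha ^ (-4 : ℤ))⁻¹ := by
  have h1 : alpha ^ (-4 : ℤ) = ia ^ 4 := by simp only [ia, inv_pow]; norm_cast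
  have h2 := ia_pos
  rw [h1, ← one_div, le_div_iff₀ (by positivity),
    show cOne * (3 * ia ^ 4) = 3 * ia ^ 6 + 3 * (ia ^ 6 * ia ^ 5) by rw [cOne_eq]; ring,
    ia_pow_six, ia_pow_five]
  linarith [ia_sq_lt]

theorem cTwo_le_inv : cTwo ≤ (alpha ^ (-1 : ℤ) + alpha ^ (-5 : ℤ))⁻¹ := by
  have h1 : alpha ^ (-1 : ℤ) = ia := by simp [ia]
  have h3 : alpha ^ (-5 : ℤ) = ia ^ 5 := by simp only [ia, inv_pow]; norm_cast
  have h2 := ia_pos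
  rw [h1, h3, ← one_div, le_div_iff₀ (by positivity),
    show cTwo * (ia + ia ^ 5) = ia ^ 4 + ia ^ 5 + ia ^ 3 * ia ^ 5 + ia ^ 3 * ia ^ 6 by
      rw [cTwo_eq]; ring,
    ia_pow_three, ia_pow_four, ia_pow_five, ia_pow_six]
  linarith [ia_lt, ia_sq_lt]

end

end C4Free

theorem theorem1p6 {V : Type*} [Fintype V] (G : SimpleGraph V) [DecidableRel G.Adj]
    (n : ℕ) (k : ℤ) (hbip : IsBalancedBipartite G n)
    (hC4 : (SimpleGraph.cycleGraph 4).Free G)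
    (hedges : (G.edgeSet.ncard : ℤ) = n + k) :
    -- part (a)
    (perm G : ℝ) ≤ alpha ^ k ∧
    -- part (b)
    (G.Connected → G.minDegree ≤ 2 → G.maxDegree ≤ 3 →
      IsEmpty (G ≃g SimpleGraph.completeGraph (Fin 2)) → IsEmpty (G ≃g SimpleGraph.cycleGraph 6) →
      IsEmpty (G ≃g graphJ) → (perm G : ℝ) ≤ cOne * alpha ^ k) ∧
    cOne ≤ (3 * alpha ^ (-4 : ℤ))⁻¹ ∧
    -- part (c)
    (G.Connected → G.minDegree ≤ 2 →
      IsEmpty (G ≃g SimpleGraph.completeGraph (Fin 2)) → IsEmpty (G ≃g SimpleGraph.cycleGraph 6) →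
      IsEmpty (G ≃g graphJ) → (perm G : ℝ) ≤ cTwo * alpha ^ k) ∧
    cTwo ≤ (alpha ^ (-1 : ℤ) + alpha ^ (-5 : ℤ))⁻¹ := by
  obtain ⟨s, t, hst, hcov, hs, ht⟩ := hbip
  have hG := C4Free.good_of_isBipartiteWith hst hC4
  have hcard := C4Free.card_eq_of_isBalancedBipartite hst.disjoint hcov hs ht
  have hw : C4Free.weight G Finset.univ = alpha ^ k := by
    -- The excess of the whole graph is `2 * (n + k) - 2 * n = 2 * k`.
    refine C4Free.weight_of_excess ?_
    rw [C4Free.excess_univ, hedges, hcard]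
    push_cast; ring
  have h := C4Free.holds (S := Finset.univ) hG
  have hlow : G.Connected → G.minDegree ≤ 2 →
      ∃ v ∈ Finset.univ, (C4Free.nb G Finset.univ v).card ≤ 2 := by
    intro hc hd
    have := hc.nonempty
    obtain ⟨v, hv⟩ := G.exists_minimal_degree_vertex
    exact ⟨v, Finset.mem_univ v, by rw [C4Free.card_nb_univ, ← hv]; exact hd⟩
  rw [C4Free.perm_eq_numPM, ← hw]
  refine ⟨h.a, fun hc hd hD h1 h2 h3 => ?_, C4Free.cOne_le_inv, fun hc hd h1 h2 h3 => ?_,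
    C4Free.cTwo_le_inv⟩
  · refine h.b (C4Free.conn_univ hc) (hlow hc hd) (fun v _ => ?_) (C4Free.not_exc_univ h1 h2 h3)
    rw [C4Free.card_nb_univ]
    exact (G.degree_le_maxDegree v).trans hD
  · exact h.c (C4Free.conn_univ hc) (hlow hc hd) (C4Free.not_exc_univ h1 h2 h3)
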